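/- Let $S$ be a unital inverse semigroup, that is, a monoid in which every $x$ has a unique $x^*$ with $xx^*x=x$ and $x^*xx^*=x^*$. Let $S_r=S\cup\{0\}$, where $0$ is a new element, $0^*=0$, and $x\bullet y=xy$ if $x,y\in S$ and $x^*x=yy^*$, while $x\bullet y=0$ otherwise; $S_r$ is an inverse semigroup. For an inverse semigroup $T$, $\ell^1(T)$ carries the convolution product $(f*g)(x)=\sum_{st=x}f(s)g(t)$ and the involution $\tilde f(x)=\overline{f(x^*)}$. Let $\ell^1_r(S)$ be the space $\ell^1(S)$ with the same involution and the product $$(f\bullet g)(x)=\sum_{y\in S,\ x^*x=yy^*}f(xy)\,g(y^*).$$ A representation of $T$ is a map $\pi:T\to B(H_\pi)$, $H_\pi$ a Hilbert space, with $\pi(x^*)=\pi(x)^*$, $\|\pi(x)\|\le 1$ and $\pi(x)\pi(y)=\pi(xy)$ for all $x,y\in T$. A restricted representation of $S$ is a map $\pi:S\to B(H_\pi)$ with $\pi(x^*)=\pi(x)^*$, $\|\pi(x)\|\le1$, and $\pi(x)\pi(y)=\pi(xy)$ if $x^*x=yy^*$, $\pi(x)\pi(y)=0$ otherwise. In both cases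 put $\tilde\pi(f)=\sum_x f(x)\pi(x)$. The left regular representation $\Lambda$ of $S_r$ on $\ell^2(S_r)$ is given by $(\Lambda(x)\xi)(y)=\xi(x^*\bullet y)$ if $y\bullet y^*\le x\bullet x^*$ (where $e\le f$ means $e\bullet f=e$), and $0$ otherwise; the restricted left regular representation $\lambda_r$ of $S$ on $\ell^2(S)$ is given by $(\lambda_r(x)\xi)(y)=\xi(x^*y)$ if $xx^*=yy^*$, and $0$ otherwise. Let $C^*_\Lambda(S_r)$ and $C^*(S_r)$ be the completions of $\ell^1(S_r)$ in the norms $\|\tilde\Lambda(f)\|$ and $\sup_\pi\|\tilde\pi(f)\|$ ($\pi$ ranging over all representations of $S_r$), and let $C^*_{\lambda_r}(S)$ and $C^*_r(S)$ be the completions of $\ell^1_r(S)$ in the norms $\|\tilde\lambda_r(f)\|$ and $\sup_\pi\|\tilde\pi(f)\|$ ($\pi$ ranging over all restricted representations of $S$). In each completion of $\ell^1(S_r)$ the line $\mathbb C\delta_0$ spanned by the point mass at $0\in S_r$ is a closed two-sided ideal. **Proposition 4.1.** There are isometric $*$-isomorphisms $$C^*_{\lambda_r}(S)\cong C^*_\Lambda(S_r)/\mathbb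 C\delta_0\qquad\text{and}\qquad C^*_r(S)\cong C^*(S_r)/\mathbb C\delta_0,$$ where the quotients carry the quotient norm. Both are induced by restriction of functions: they identify the class of $f\in\ell^1(S_r)$ with $f|_S\in\ell^1_r(S)$. -/

import Mathlib

noncomputable section

namespace RestrictedAlgebra

universe u

/-- An inverse semigroup: every `x` has a unique `star x` with
`x * star x * x = x` and `star x * x * star x = star x`. -/
class InverseSemigroup (S : Type u) [Semigroup S] extends Star S where
  mul_star_mul (x : S) : x * star x * x = x
  star_mul_self_mul_star (x : S) : star x * x * star x = star x
  eq_star (x y : S) : x * y * x = x → y * x * y = y → y = star x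

section InverseSemigroup

variable {S : Type u} [Semigroup S] [InverseSemigroup S]

open InverseSemigroup

theorem star_star' (x : S) : star (star x) = x :=
  (eq_star _ _ (star_mul_self_mul_star x) (mul_star_mul x)).symm

theorem idem_mul_idem {e f : S} (he : e * e = e) (hf : f * f = f) :
    e * f * (e * f) = e * f ∧ star (e * f) = e * f := by
  set x := star (e * f) with hx
  have h1 : e * f * x * (e * f) = e * f := mul_star_mul _
  have h2 : x * (e * f) * x = x := star_mul_self_mul_star _
  have h3 : f * x * e = x := by
    apply eq_star
    · calc e * f * (f * x * e) * (e * f) = e * (f * f) * x * ((e * e) * f) := by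
            simp only [mul_assoc]
        _ = e * f := by rw [he, hf]; exact h1
    · calc f * x * e * (e * f) * (f * x * e) = f * (x * ((e * e) * (f * f)) * x) * e := by
            simp only [mul_assoc]
        _ = f * x * e := by rw [he, hf, h2]
  have h4 : x * x = x := by
    calc x * x = f * x * e * (f * x * e) := by rw [h3]
      _ = f * (x * (e * f) * x) * e := by simp only [mul_assoc]
      _ = x := by rw [h2, h3]
  have h5 : x = star x := eq_star _ _ (by rw [h4, h4]) (by rw [h4, h4])
  have h6 : e * f = x := by rw [h5, hx, star_star']
  exact ⟨by rw [h6, h4], h6.symm⟩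

theorem idem_comm {e f : S} (he : e * e = e) (hf : f * f = f) : e * f = f * e := by
  obtain ⟨h1, h2⟩ := idem_mul_idem he hf
  obtain ⟨h3, -⟩ := idem_mul_idem hf he
  have : f * e = star (e * f) := by
    apply eq_star
    · calc e * f * (f * e) * (e * f) = e * (f * f) * ((e * e) * f) := by simp only [mul_assoc]
        _ = e * f := by rw [he, hf, h1]
    · calc f * e * (e * f) * (f * e) = f * (e * e) * ((f * f) * e) := by simp only [mul_assoc]
        _ = f * e := by rw [he, hf, h3]
  rw [this, h2]

theorem idem_range (x : S) : x * star x * (x * star x) = x * star x := by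
  rw [← mul_assoc, mul_star_mul]

theorem idem_source (x : S) : star x * x * (star x * x) = star x * x := by
  rw [← mul_assoc, star_mul_self_mul_star]

theorem star_mul' (x y : S) : star (x * y) = star y * star x := by
  have h := idem_comm (idem_range y) (idem_source x)
  symm
  apply eq_star
  · calc x * y * (star y * star x) * (x * y)
        = x * ((y * star y) * (star x * x)) * y := by simp only [mul_assoc]
      _ = (x * star x * x) * (y * star y * y) := by rw [h]; simp only [mul_assoc]
      _ = x * y := by rw [mul_star_mul, mul_star_mul]
  · calc star y * star x * (x * y) * (star y * star x)
        = star y * ((star x * x) * (y * star y)) * star x := by simp only [mul_assoc]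
      _ = (star y * y * star y) * (star x * x * star x) := by rw [← h]; simp only [mul_assoc]
      _ = star y * star x := by rw [star_mul_self_mul_star, star_mul_self_mul_star]

instance : StarMul S where
  star_involutive := star_star'
  star_mul := star_mul'

/-- The natural order on idempotents: `e ≤ f` iff `e * f = e`. -/
def IdemLE (e f : S) : Prop := e * f = e

end InverseSemigroup

/-! ### The restricted semigroup -/

/-- The set `S ∪ {0}`, where `0` is a new element. -/
inductive RestrictedSemigroup (S : Type u) : Type u
  | zero : RestrictedSemigroup S
  | of (x : S) : RestrictedSemigroup S

section RestrictedSemigroup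

variable (S : Type u) [Semigroup S] [InverseSemigroup S]

/-- The pairs for which the restricted product `x * y` is defined: `x⋆ x = y y⋆`. -/
def Composable (x y : S) : Prop := star x * x = y * star y

/-- All pairs. -/
def AllPairs (T : Type u) (_ _ : T) : Prop := True

variable {S}

namespace RestrictedSemigroup

open Classical in
/-- `x • y = x y` if `x⋆ x = y y⋆`, and `0` otherwise. -/
instance : Mul (RestrictedSemigroup S) where
  mul
    | of x, of y => if Composable S x y then of (x * y) else zero
    | _, _ => zero

instance : Star (RestrictedSemigroup S) where
  star
    | of x => of (star x)
    | zero => zero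

open Classical in
theorem of_mul_of (x y : S) :
    (of x * of y : RestrictedSemigroup S) = if Composable S x y then of (x * y) else zero := rfl

@[simp] theorem zero_mul' (x : RestrictedSemigroup S) : zero * x = zero := rfl
@[simp] theorem mul_zero' (x : RestrictedSemigroup S) : x * zero = zero := by cases x <;> rfl
@[simp] theorem star_of (x : S) : star (of x) = of (star x) := rfl
@[simp] theorem star_zero' : star (zero : RestrictedSemigroup S) = zero := rfl

end RestrictedSemigroup

open InverseSemigroup

/-- A relation on pairs whose defined products form an associative partial `*`-semigroup. -/
class IsProductDomain {T : Type u} [Semigroup T] [InverseSemigroup T] (D : T → T → Prop) :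
    Prop where
  assoc (a b c : T) : D a b ∧ D (a * b) c ↔ D b c ∧ D a (b * c)
  star_iff (a b : T) : D (star b) (star a) ↔ D a b

instance (T : Type u) [Semigroup T] [InverseSemigroup T] : IsProductDomain (AllPairs T) :=
  ⟨fun _ _ _ => Iff.rfl, fun _ _ => Iff.rfl⟩

theorem Composable.source {a b : S} (h : Composable S a b) :
    star (a * b) * (a * b) = star b * b := by
  calc star (a * b) * (a * b) = star b * (star a * a) * b := by
        rw [star_mul]; simp only [mul_assoc]
    _ = (star b * b * star b) * b := by rw [h]; simp only [mul_assoc]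
    _ = star b * b := by rw [star_mul_self_mul_star]

theorem Composable.range {a b : S} (h : Composable S a b) :
    a * b * star (a * b) = a * star a := by
  calc a * b * star (a * b) = a * (b * star b) * star a := by
        rw [star_mul]; simp only [mul_assoc]
    _ = (a * star a * a) * star a := by rw [← h]; simp only [mul_assoc]
    _ = a * star a := by rw [mul_star_mul]

instance : IsProductDomain (Composable S) where
  assoc a b c := by
    constructor
    · rintro ⟨h1, h2⟩
      have h3 : Composable S b c := h1.source.symm.trans h2
      exact ⟨h3, Eq.trans h1 h3.range.symm⟩
    · rintro ⟨h1, h2⟩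
      have h3 : Composable S a b := Eq.trans h2 h1.range
      exact ⟨h3, h3.source.trans h1⟩
  star_iff a b := by
    simp only [Composable, star_star]
    exact eq_comm

namespace RestrictedSemigroup

instance : Semigroup (RestrictedSemigroup S) where
  mul_assoc x y z := by
    rcases x with _ | x
    · rfl
    rcases y with _ | y
    · simp
    rcases z with _ | z
    · simp
    have h := IsProductDomain.assoc (D := Composable S) x y z
    by_cases h1 : Composable S x y <;> by_cases h2 : Composable S y z <;>
      simp only [of_mul_of, h1, h2, if_true, if_false, zero_mul', mul_zero', true_and,
        false_and, iff_false, false_iff] at h ⊢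
    · by_cases h3 : Composable S x (y * z)
      · rw [if_pos h3, if_pos (h.2 h3), mul_assoc]
      · rw [if_neg h3, if_neg (fun h4 => h3 (h.1 h4))]
    · simp [h]
    · simp [h]

instance : InverseSemigroup (RestrictedSemigroup S) where
  mul_star_mul x := by
    rcases x with _ | x
    · rfl
    · have h1 : Composable S x (star x) := by simp [Composable]
      have h2 : Composable S (x * star x) x := by
        rw [Composable, h1.source]; simp
      simp [of_mul_of, h1, h2, mul_star_mul]
  star_mul_self_mul_star x := by
    rcases x with _ | x
    · rfl
    · have h1 : Composable S (star x) x := by simp [Composable]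
      have h2 : Composable S (star x * x) (star x) := by
        rw [Composable, h1.source]; simp
      simp [of_mul_of, h1, h2, star_mul_self_mul_star]
  eq_star x y h1 h2 := by
    rcases x with _ | x
    · simpa using h2.symm
    · rcases y with _ | y
      · simp at h1
      · by_cases h3 : Composable S x y <;> by_cases h4 : Composable S y x <;>
          by_cases h5 : Composable S (x * y) x <;> by_cases h6 : Composable S (y * x) y <;>
          simp [of_mul_of, h3, h4, h5, h6] at h1 h2 ⊢
        exact eq_star _ _ h1 h2

end RestrictedSemigroup

end RestrictedSemigroup


/-! ### The `ℓ¹` algebras -/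

section L1

open scoped ENNReal
/-- The Banach space `ℓ¹(T)`, as carrier of the algebra whose product is the convolution over the
pairs in `D`. -/
def L1 {T : Type u} (_ : T → T → Prop) : Type u := lp (fun _ : T => ℂ) 1

variable {T : Type u} {D : T → T → Prop}

namespace L1

instance : NormedAddCommGroup (L1 D) := inferInstanceAs (NormedAddCommGroup (lp (fun _ : T => ℂ) 1))
instance : NormedSpace ℂ (L1 D) := inferInstanceAs (NormedSpace ℂ (lp (fun _ : T => ℂ) 1))
instance : CompleteSpace (L1 D) := inferInstanceAs (CompleteSpace (lp (fun _ : T => ℂ) 1))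

/-- The underlying function of an element of `ℓ¹(T)`. -/
def toFun (f : L1 D) : T → ℂ := f.1

instance : CoeFun (L1 D) (fun _ => T → ℂ) := ⟨toFun⟩

theorem ext {f g : L1 D} (h : ∀ x, f x = g x) : f = g := lp.ext (funext h)

@[simp] theorem add_apply (f g : L1 D) (x : T) : (f + g) x = f x + g x := rfl
@[simp] theorem smul_apply (c : ℂ) (f : L1 D) (x : T) : (c • f) x = c * f x := rfl

theorem summable_norm (f : L1 D) : Summable fun x => ‖f x‖ := by
  have := (lp.memℓp f).summable (by simp)
  simp only [ENNReal.toReal_one, Real.rpow_one] at this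
  exact this

theorem norm_eq (f : L1 D) : ‖f‖ = ∑' x, ‖f x‖ := by
  refine (lp.norm_eq_tsum_rpow (p := 1) (by simp) f).trans ?_
  simp only [ENNReal.toReal_one, Real.rpow_one, div_one]
  rfl

/-- The function on `T` with absolutely summable values, as an element of `ℓ¹(T)`. -/
def mk (f : T → ℂ) (hf : Summable fun x => ‖f x‖) : L1 D :=
  ⟨f, memℓp_gen (by simpa using hf)⟩

@[simp] theorem mk_apply (f : T → ℂ) (hf : Summable fun x => ‖f x‖) (x : T) :
    (mk f hf : L1 D) x = f x := rfl

/-- Evaluation at a point. -/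
def eval (x : T) : L1 D →L[ℂ] ℂ := lp.evalCLM ℂ (fun _ : T => ℂ) 1 x

@[simp] theorem eval_apply (x : T) (f : L1 D) : eval x f = f x := rfl

open Classical in
/-- The point mass at `x`. -/
def delta (D : T → T → Prop) (x : T) : L1 D := lp.single 1 x (1 : ℂ)

open Classical in
theorem delta_apply (x y : T) : delta D x y = if y = x then 1 else 0 := by
  change (lp.single 1 x (1 : ℂ) : lp (fun _ : T => ℂ) 1).1 y = _
  by_cases h : y = x
  · subst h; simp
  · simp [h]

theorem norm_delta (x : T) : ‖delta D x‖ = 1 := by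
  classical
  have := lp.norm_single (E := fun _ : T => ℂ) (p := 1) (by simp) x (1 : ℂ)
  rw [norm_one] at this
  exact this

theorem clm_ext {E : Type*} [NormedAddCommGroup E] [NormedSpace ℂ E] {A B : L1 D →L[ℂ] E}
    (h : ∀ x, A (delta D x) = B (delta D x)) : A = B := by
  classical
  ext f
  have hs : HasSum (fun i => lp.single 1 i (f i)) f := lp.hasSum_single (by simp) f
  have key : ∀ i, A (lp.single 1 i (f i) : lp (fun _ : T => ℂ) 1) =
      B (lp.single 1 i (f i) : lp (fun _ : T => ℂ) 1) := by
    intro i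
    have : (lp.single 1 i (f i) : lp (fun _ : T => ℂ) 1) = (f i • delta D i : L1 D) := by
      refine ext fun j => ?_
      rw [smul_apply, delta_apply]
      change (lp.single 1 i (f i) : lp (fun _ : T => ℂ) 1).1 j = _
      by_cases h : j = i
      · subst h; simp
      · simp [h]
    rw [this, map_smul, map_smul, h]
  have hA : HasSum (fun i => A (lp.single 1 i (f i) : lp (fun _ : T => ℂ) 1)) (A f) :=
    A.hasSum hs
  have hB : HasSum (fun i => B (lp.single 1 i (f i) : lp (fun _ : T => ℂ) 1)) (B f) :=
    B.hasSum hs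
  simp only [key] at hA
  exact hA.unique hB

section lift

variable {E : Type*} [NormedAddCommGroup E] [NormedSpace ℂ E] [CompleteSpace E]

theorem summable_smul (φ : T → E) (hφ : ∀ x, ‖φ x‖ ≤ 1) (f : L1 D) :
    Summable fun x => f x • φ x := by
  refine Summable.of_norm_bounded (summable_norm f) fun x => ?_
  rw [norm_smul]
  exact mul_le_of_le_one_right (norm_nonneg _) (hφ x)

/-- The map `f ↦ ∑ x, f x • φ x`. -/
def lift (φ : T → E) (hφ : ∀ x, ‖φ x‖ ≤ 1) : L1 D →L[ℂ] E :=
  LinearMap.mkContinuous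
    { toFun := fun f => ∑' x, f x • φ x
      map_add' := fun f g => by
        rw [← (summable_smul φ hφ f).tsum_add (summable_smul φ hφ g)]
        exact tsum_congr fun x => add_smul _ _ _
      map_smul' := fun c f => by
        rw [RingHom.id_apply, ← (summable_smul φ hφ f).tsum_const_smul]
        exact tsum_congr fun x => mul_smul _ _ _ } 1 fun f => by
    rw [one_mul, norm_eq]
    refine tsum_of_norm_bounded (summable_norm f).hasSum fun x => ?_
    rw [norm_smul]
    exact mul_le_of_le_one_right (norm_nonneg _) (hφ x)

theorem lift_apply (φ : T → E) (hφ : ∀ x, ‖φ x‖ ≤ 1) (f : L1 D) :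
    lift φ hφ f = ∑' x, f x • φ x := rfl

theorem norm_lift_le (φ : T → E) (hφ : ∀ x, ‖φ x‖ ≤ 1) : ‖lift (D := D) φ hφ‖ ≤ 1 :=
  LinearMap.mkContinuous_norm_le _ zero_le_one _

@[simp] theorem lift_delta (φ : T → E) (hφ : ∀ x, ‖φ x‖ ≤ 1) (x : T) :
    lift φ hφ (delta D x) = φ x := by
  rw [lift_apply, tsum_eq_single x]
  · simp [delta_apply]
  · intro y hy
    simp [delta_apply, hy]

end lift

theorem summable_norm_prod {T : Type u} {D : T → T → Prop} (f g : L1 D) :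
    Summable fun p : T × T => ‖f p.1 * g p.2‖ := by
  have h := Summable.mul_of_nonneg (f := fun x => ‖f x‖) (g := fun x => ‖g x‖)
    (summable_norm f) (summable_norm g) (fun _ => norm_nonneg _) (fun _ => norm_nonneg _)
  refine h.congr fun p => ?_
  rw [norm_mul]

section mul

variable [Semigroup T]

variable (D) in
open Classical in
/-- The bilinear extension of the partial product on `T`. -/
def mulL : L1 D →L[ℂ] L1 D →L[ℂ] L1 D :=
  lift (fun s => lift (fun t => if D s t then delta D (s * t) else 0) (fun t => by
    split_ifs <;> simp [norm_delta])) (fun _ => norm_lift_le _ _)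

open Classical in
theorem mulL_delta (s t : T) :
    mulL D (delta D s) (delta D t) = if D s t then delta D (s * t) else 0 := by
  simp [mulL]

variable (D) in
/-- The pairs in `D` with product `x`. -/
abbrev Factor (x : T) : Type u := {p : T × T // D p.1 p.2 ∧ p.1 * p.2 = x}

theorem mulL_apply (f g : L1 D) (x : T) :
    mulL D f g x = ∑' p : Factor D x, f p.1.1 * g p.1.2 := by
  classical
  have h1 : mulL D f g x = ∑' s, f s * ∑' t, g t * if D s t ∧ s * t = x then 1 else 0 := by
    have e1 : mulL D f = ∑' s, f s • (lift (fun t => if D s t then delta D (s * t) else 0)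
      (fun t => by split_ifs <;> simp [norm_delta]) : L1 D →L[ℂ] L1 D) := rfl
    have hs := summable_smul (D := D) (fun s => (lift (fun t => if D s t then delta D (s * t) else 0)
      (fun t => by split_ifs <;> simp [norm_delta]) : L1 D →L[ℂ] L1 D))
      (fun _ => norm_lift_le _ _) f
    have := ((ContinuousLinearMap.apply ℂ (L1 D) g).hasSum hs.hasSum)
    have := ((eval x).hasSum this).tsum_eq
    rw [← e1] at this
    change _ = mulL D f g x at this
    rw [← this]
    refine tsum_congr fun s => ?_
    change f s * (lift _ _ g : L1 D) x = _
    congr 1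
    have hs2 := summable_smul (D := D) (fun t => if D s t then delta D (s * t) else 0)
      (fun t => by split_ifs <;> simp [norm_delta]) g
    have := ((eval x).hasSum hs2.hasSum).tsum_eq
    change _ = (lift _ (fun t => by split_ifs <;> simp [norm_delta]) g : L1 D) x at this
    rw [← this]
    refine tsum_congr fun t => ?_
    change g t * (ite _ _ _ : L1 D) x = _
    congr 1
    by_cases h : D s t
    · rw [if_pos h, delta_apply]; simp [h, eq_comm]
    · rw [if_neg h]; simp [h]; rfl
  have h2 : ∑' p : Factor D x, f p.1.1 * g p.1.2 =
      ∑' p : T × T, Set.indicator {p : T × T | D p.1 p.2 ∧ p.1 * p.2 = x}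
        (fun p => f p.1 * g p.2) p :=
    tsum_subtype {p : T × T | D p.1 p.2 ∧ p.1 * p.2 = x} (fun p => f p.1 * g p.2)
  rw [h1, h2]
  have hsum : Summable (Set.indicator {p : T × T | D p.1 p.2 ∧ p.1 * p.2 = x}
        (fun p => f p.1 * g p.2)) := (summable_norm_prod f g).of_norm.indicator _
  rw [hsum.tsum_prod]
  refine tsum_congr fun s => ?_
  rw [← tsum_mul_left]
  refine tsum_congr fun t => ?_
  by_cases h : D s t ∧ s * t = x
  · rw [Set.indicator_of_mem (by exact h), if_pos h, mul_one]
  · rw [Set.indicator_of_notMem (by exact h), if_neg h, mul_zero, mul_zero]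

/-- `(f * g) x = ∑ f s * g t`, summed over all pairs `(s, t)` in `D` with `s * t = x`. -/
instance : Mul (L1 D) where
  mul f g := mk (fun x => ∑' p : Factor D x, f p.1.1 * g p.1.2) (by
    simp only [← mulL_apply]; exact summable_norm _)

theorem mul_apply (f g : L1 D) (x : T) :
    (f * g) x = ∑' p : Factor D x, f p.1.1 * g p.1.2 := rfl

theorem mul_eq (f g : L1 D) : f * g = mulL D f g :=
  ext fun x => (mul_apply f g x).trans (mulL_apply f g x).symm

open Classical in
theorem delta_mul_delta (s t : T) :
    delta D s * delta D t = if D s t then delta D (s * t) else 0 := by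
  rw [mul_eq, mulL_delta]

variable [InverseSemigroup T]

theorem mul_assoc' [IsProductDomain D] (f g h : L1 D) : f * g * h = f * (g * h) := by
  simp only [mul_eq]
  have e3 : ∀ s t h, mulL D (mulL D (delta D s) (delta D t)) h =
      mulL D (delta D s) (mulL D (delta D t) h) := by
    intro s t h
    have : mulL D (mulL D (delta D s) (delta D t)) =
        (mulL D (delta D s)).comp (mulL D (delta D t)) := by
      refine clm_ext fun r => ?_
      have h := IsProductDomain.assoc (D := D) s t r
      rw [ContinuousLinearMap.comp_apply, mulL_delta, mulL_delta]
      by_cases h1 : D s t <;> by_cases h2 : D t r <;>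
        simp only [h1, h2, true_and, false_and, iff_false, false_iff, if_true, if_false, map_zero,
          mulL_delta, _root_.zero_apply] at h ⊢
      · by_cases h3 : D s (t * r)
        · rw [if_pos h3, if_pos (h.2 h3), mul_assoc]
        · rw [if_neg h3, if_neg (fun h4 => h3 (h.1 h4))]
      · rw [if_neg h]
      · rw [if_neg h]
    rw [this]; rfl
  have e2 : ∀ s g h, mulL D (mulL D (delta D s) g) h = mulL D (delta D s) (mulL D g h) := by
    intro s g h
    have : ((mulL D).flip h).comp (mulL D (delta D s)) =
        (mulL D (delta D s)).comp ((mulL D).flip h) := clm_ext fun t => e3 s t h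
    exact DFunLike.congr_fun this g
  have : ((mulL D).flip h).comp ((mulL D).flip g) = (mulL D).flip (mulL D g h) :=
    clm_ext fun s => e2 s g h
  exact DFunLike.congr_fun this f

/-- The involution `f̃ x = conj (f (x⋆))`. -/
instance : Star (L1 D) where
  star f := mk (fun x => star (f (star x))) (by
    simp only [norm_star]
    exact (summable_norm f).comp_injective star_injective)

theorem star_apply (f : L1 D) (x : T) : star f x = star (f (star x)) := rfl

instance nonUnitalRing [IsProductDomain D] : NonUnitalRing (L1 D) where
  left_distrib f g h := by simp only [mul_eq, map_add]
  right_distrib f g h := by simp only [mul_eq, map_add, _root_.add_apply]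
  zero_mul f := by simp only [mul_eq, map_zero, _root_.zero_apply]
  mul_zero f := by simp only [mul_eq, map_zero]
  mul_assoc := mul_assoc'

instance starRing [IsProductDomain D] : StarRing (L1 D) where
  star_involutive f := ext fun x => by simp [star_apply]
  star_add f g := ext fun x => by simp [star_apply]
  star_mul f g := ext fun x => by
    rw [star_apply, mul_apply, mul_apply, tsum_star]
    let e : Factor D x ≃ Factor D (star x) :=
      { toFun := fun p => ⟨(star p.1.2, star p.1.1), (IsProductDomain.star_iff _ _).2 p.2.1, by
          rw [← star_mul, p.2.2]⟩
        invFun := fun p => ⟨(star p.1.2, star p.1.1), (IsProductDomain.star_iff _ _).2 p.2.1, by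
          rw [← star_mul, p.2.2, star_star]⟩
        left_inv := fun p => Subtype.ext (by simp)
        right_inv := fun p => Subtype.ext (by simp) }
    rw [← e.tsum_eq]
    refine tsum_congr fun p => ?_
    change star (f (star p.1.2) * g (star p.1.1)) = star (g (star p.1.1)) * star (f (star p.1.2))
    exact star_mul _ _

instance : StarModule ℂ (L1 D) where
  star_smul c f := ext fun x => by simp [star_apply]

instance [IsProductDomain D] : IsScalarTower ℂ (L1 D) (L1 D) where
  smul_assoc c f g := by simp [mul_eq]

instance [IsProductDomain D] : SMulCommClass ℂ (L1 D) (L1 D) where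
  smul_comm c f g := by simp [mul_eq]

end mul

/-- For composable pairs the product is the dot product
`(f • g) x = ∑ f (x y) g (y⋆)`, summed over all `y` with `x⋆ x = y y⋆`. -/
theorem dot_apply {S : Type u} [Semigroup S] [InverseSemigroup S] (f g : L1 (Composable S))
    (x : S) :
    (f * g) x = ∑' y : {y : S // star x * x = y * star y}, f (x * y.1) * g (star y.1) := by
  rw [mul_apply]
  let e : {y : S // star x * x = y * star y} ≃ Factor (Composable S) x :=
    { toFun := fun y => ⟨(x * y.1, star y.1), by
        rw [Composable, Composable.source y.2, star_star], by
        rw [mul_assoc, ← y.2, ← mul_assoc, InverseSemigroup.mul_star_mul]⟩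
      invFun := fun p => ⟨star p.1.2, by
        have h := Composable.source p.2.1
        rw [p.2.2] at h
        rw [h, star_star]⟩
      left_inv := fun y => Subtype.ext (star_star _)
      right_inv := fun p => Subtype.ext (Prod.ext (by
        have h : star p.1.1 * p.1.1 = p.1.2 * star p.1.2 := p.2.1
        change x * star p.1.2 = p.1.1
        calc x * star p.1.2 = p.1.1 * p.1.2 * star p.1.2 := by rw [p.2.2]
          _ = p.1.1 := by rw [mul_assoc, ← h, ← mul_assoc, InverseSemigroup.mul_star_mul]) (star_star _)) }
  exact (e.tsum_eq (fun p : Factor (Composable S) x => f p.1.1 * g p.1.2)).symm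

end L1

end L1

/-! ### Representations -/

section Rep

variable {T : Type u} [Semigroup T] [InverseSemigroup T]

/-- `π : T → B(H)` is a contractive `*`-representation that is multiplicative on the pairs in `D`,
with `π x * π y = 0` on the other pairs. For `D = AllPairs T` this is a `*`-representation of `T`,
for `D = Composable T` a restricted representation of `T`. -/
structure IsRep {H : Type u} [NormedAddCommGroup H] [InnerProductSpace ℂ H] [CompleteSpace H]
    (D : T → T → Prop) (π : T → H →L[ℂ] H) : Prop where
  map_mul (x y : T) : D x y → π x * π y = π (x * y)
  map_mul_eq_zero (x y : T) : ¬ D x y → π x * π y = 0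
  map_star (x : T) : π (star x) = star (π x)
  norm_le (x : T) : ‖π x‖ ≤ 1

/-- A representation in the sense of `IsRep`, with its Hilbert space. Hilbert spaces are taken in
the universe of `T`: every cyclic representation lives on a completion of a quotient of `ℓ¹(T)`, so
that larger universes give the same norms. -/
structure Rep (D : T → T → Prop) where
  H : Type u
  [normedAddCommGroup : NormedAddCommGroup H]
  [innerProductSpace : InnerProductSpace ℂ H]
  [completeSpace : CompleteSpace H]
  π : T → H →L[ℂ] H
  isRep : IsRep D π

attribute [instance] Rep.normedAddCommGroup Rep.innerProductSpace Rep.completeSpace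

namespace Rep

variable {D : T → T → Prop} (ρ : Rep D)

/-- The lift `π̃ f = ∑ x, f x • π x` of a representation to the `ℓ¹` algebra. -/
def tilde (f : L1 D) : ρ.H →L[ℂ] ρ.H := ∑' x, f x • ρ.π x

/-- `tilde` as a continuous linear map. -/
def tildeL : L1 D →L[ℂ] (ρ.H →L[ℂ] ρ.H) := L1.lift ρ.π ρ.isRep.norm_le

theorem tildeL_apply (f : L1 D) : ρ.tildeL f = ρ.tilde f := rfl

theorem norm_tilde_le (f : L1 D) : ‖ρ.tilde f‖ ≤ ‖f‖ := by
  rw [← tildeL_apply]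
  exact (ρ.tildeL.le_of_opNorm_le (L1.norm_lift_le _ _) f).trans (one_mul _).le

theorem tilde_add (f g : L1 D) : ρ.tilde (f + g) = ρ.tilde f + ρ.tilde g := map_add ρ.tildeL f g

theorem tilde_smul (c : ℂ) (f : L1 D) : ρ.tilde (c • f) = c • ρ.tilde f := map_smul ρ.tildeL c f

theorem tilde_delta (x : T) : ρ.tilde (L1.delta D x) = ρ.π x := L1.lift_delta ρ.π ρ.isRep.norm_le x

theorem tilde_mul (f g : L1 D) : ρ.tilde (f * g) = ρ.tilde f * ρ.tilde g := by
  classical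
  simp only [← tildeL_apply, L1.mul_eq]
  have e2 : ∀ s g, ρ.tildeL (L1.mulL D (L1.delta D s) g) =
      ρ.tildeL (L1.delta D s) * ρ.tildeL g := by
    intro s g
    have : ρ.tildeL.comp (L1.mulL D (L1.delta D s)) =
        (ContinuousLinearMap.mul ℂ (ρ.H →L[ℂ] ρ.H) (ρ.tildeL (L1.delta D s))).comp ρ.tildeL := by
      refine L1.clm_ext fun t => ?_
      rw [ContinuousLinearMap.comp_apply, ContinuousLinearMap.comp_apply,
        ContinuousLinearMap.mul_apply', L1.mulL_delta, tildeL_apply, tildeL_apply, tildeL_apply,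
        tilde_delta, tilde_delta]
      by_cases h : D s t
      · rw [if_pos h, tilde_delta, ρ.isRep.map_mul _ _ h]
      · rw [if_neg h, ρ.isRep.map_mul_eq_zero _ _ h]
        exact map_zero ρ.tildeL
    exact DFunLike.congr_fun this g
  have : ρ.tildeL.comp ((L1.mulL D).flip g) =
      ((ContinuousLinearMap.mul ℂ (ρ.H →L[ℂ] ρ.H)).flip (ρ.tildeL g)).comp ρ.tildeL :=
    L1.clm_ext fun s => e2 s g
  exact DFunLike.congr_fun this f

theorem tilde_star (f : L1 D) : ρ.tilde (star f) = star (ρ.tilde f) := by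
  rw [tilde, tilde, tsum_star, ← (Equiv.tsum_eq (star_involutive.toPerm _))]
  refine tsum_congr fun x => ?_
  change star (f (star (star x))) • ρ.π (star x) = star (f x • ρ.π x)
  rw [star_star, ρ.isRep.map_star, star_smul]

end Rep

/-! ### The regular representations -/

open scoped ENNReal

/-- The Hilbert space `ℓ²(T)`. -/
abbrev L2 (T : Type u) : Type u := lp (fun _ : T => ℂ) 2

theorem L2.summable_sq {T : Type u} (ξ : L2 T) : Summable fun x => ‖ξ x‖ ^ (2 : ℝ≥0∞).toReal :=
  (lp.memℓp ξ).summable (by simp)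

open Classical in
theorem L2.pull_aux {T : Type u} (P : T → Prop) (g : T → T) (hg : Set.InjOn g {y | P y})
    (ξ : L2 T) : Summable (fun y => ‖if P y then ξ (g y) else 0‖ ^ (2 : ℝ≥0∞).toReal) ∧
      (∑' y, ‖if P y then ξ (g y) else 0‖ ^ (2 : ℝ≥0∞).toReal) ≤
        ∑' y, ‖ξ y‖ ^ (2 : ℝ≥0∞).toReal := by
  have e : (fun y => ‖if P y then ξ (g y) else 0‖ ^ (2 : ℝ≥0∞).toReal) =
      Set.indicator {y | P y} (fun y => ‖ξ (g y)‖ ^ (2 : ℝ≥0∞).toReal) := by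
    funext y
    by_cases h : P y <;> simp [Set.indicator, h]
  have hi : Function.Injective (fun y : {y | P y} => g y) := Set.injOn_iff_injective.1 hg
  rw [e]
  refine ⟨summable_subtype_iff_indicator.1 ((L2.summable_sq ξ).comp_injective hi), ?_⟩
  rw [← tsum_subtype {y | P y} (fun y => ‖ξ (g y)‖ ^ (2 : ℝ≥0∞).toReal)]
  exact _root_.tsum_comp_le_tsum_of_inj (L2.summable_sq ξ) (fun _ => by positivity) hi

open Classical in
/-- The operator sending `ξ` to the function with value `ξ (g y)` at `y` if `P y`, and `0`
otherwise, where `g` is injective on `P`. -/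
def L2.pull {T : Type u} (P : T → Prop) (g : T → T) (hg : Set.InjOn g {y | P y}) :
    L2 T →L[ℂ] L2 T :=
  LinearMap.mkContinuous
    { toFun := fun ξ => ⟨fun y => if P y then ξ (g y) else 0,
        memℓp_gen (L2.pull_aux P g hg ξ).1⟩
      map_add' := fun ξ η => by
        refine lp.ext (funext fun y => ?_)
        change (if P y then ξ (g y) + η (g y) else 0) =
          (if P y then ξ (g y) else 0) + (if P y then η (g y) else 0)
        split_ifs <;> simp
      map_smul' := fun c ξ => by
        refine lp.ext (funext fun y => ?_)
        change (if P y then c * ξ (g y) else 0) = c * (if P y then ξ (g y) else 0)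
        split_ifs <;> simp } 1 fun ξ => by
    rw [one_mul]
    refine lp.norm_le_of_tsum_le (by simp) (norm_nonneg _) ?_
    rw [lp.norm_rpow_eq_tsum (by simp)]
    exact (L2.pull_aux P g hg ξ).2

namespace L2

section

variable {T : Type u} {P Q : T → Prop} {g h : T → T} {hg : Set.InjOn g {y | P y}}
  {hh : Set.InjOn h {y | Q y}}

open Classical in
theorem pull_apply (ξ : L2 T) (y : T) : pull P g hg ξ y = if P y then ξ (g y) else 0 := rfl

theorem norm_pull_le : ‖pull P g hg‖ ≤ 1 := LinearMap.mkContinuous_norm_le _ zero_le_one _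

theorem star_pull (h1 : ∀ y, P y → Q (g y) ∧ h (g y) = y)
    (h2 : ∀ y, Q y → P (h y) ∧ g (h y) = y) : pull Q h hh = star (pull P g hg) := by
  classical
  rw [ContinuousLinearMap.star_eq_adjoint, ContinuousLinearMap.eq_adjoint_iff]
  intro ξ η
  rw [lp.inner_eq_tsum, lp.inner_eq_tsum]
  have e1 : ∀ y, inner ℂ (pull Q h hh ξ y) (η y) =
      Set.indicator {y | Q y} (fun y => inner ℂ (ξ (h y)) (η y)) y := by
    intro y
    rw [pull_apply]
    by_cases hy : Q y <;> simp [Set.indicator, hy]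
  have e2 : ∀ y, inner ℂ (ξ y) (pull P g hg η y) =
      Set.indicator {y | P y} (fun y => inner ℂ (ξ y) (η (g y))) y := by
    intro y
    rw [pull_apply]
    by_cases hy : P y <;> simp [Set.indicator, hy]
  simp only [e1, e2]
  rw [← tsum_subtype {y | Q y} (fun y => inner ℂ (ξ (h y)) (η y)),
    ← tsum_subtype {y | P y} (fun y => inner ℂ (ξ y) (η (g y)))]
  let e : {y | P y} ≃ {y | Q y} :=
    { toFun := fun y => ⟨g y.1, (h1 y.1 y.2).1⟩
      invFun := fun y => ⟨h y.1, (h2 y.1 y.2).1⟩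
      left_inv := fun y => Subtype.ext (h1 y.1 y.2).2
      right_inv := fun y => Subtype.ext (h2 y.1 y.2).2 }
  rw [← e.tsum_eq]
  refine tsum_congr fun y => ?_
  change inner ℂ (ξ (h (g y.1))) (η (g y.1)) = _
  rw [(h1 y.1 y.2).2]

end

end L2

open InverseSemigroup

theorem idemLE_iff (x y : T) :
    IdemLE (y * star y) (x * star x) ↔ x * (star x * y) = y := by
  have hc := idem_comm (idem_range y) (idem_range x)
  constructor
  · intro h
    unfold IdemLE at h
    rw [hc] at h
    calc x * (star x * y) = x * (star x * (y * star y * y)) := by rw [mul_star_mul]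
      _ = x * star x * (y * star y) * y := by simp only [mul_assoc]
      _ = y := by rw [h, mul_star_mul]
  · intro h
    unfold IdemLE
    rw [hc]
    calc x * star x * (y * star y) = x * (star x * y) * star y := by simp only [mul_assoc]
      _ = y * star y := by rw [h]

theorem cancel_of_range_eq {x y : T} (h : x * star x = y * star y) : x * (star x * y) = y := by
  rw [← mul_assoc, h, mul_star_mul]

theorem star_cancel (x y : T) : star x * (x * (star x * y)) = star x * y := by
  rw [← mul_assoc, ← mul_assoc, star_mul_self_mul_star]

theorem range_star_mul {x y : T} (h : x * star x = y * star y) :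
    star x * y * star (star x * y) = star x * x := by
  calc star x * y * star (star x * y) = star x * (y * star y) * x := by
        rw [star_mul, star_star]; simp only [mul_assoc]
    _ = star x * x * (star x * x) := by rw [← h]; simp only [mul_assoc]
    _ = star x * x := idem_source x

/-- The operators of the left regular representation:
`λ(x) ξ (y) = ξ (x⋆ y)` if `x x⋆ ≥ y y⋆`, and `0` otherwise. -/
def leftRegularOp (x : T) : L2 T →L[ℂ] L2 T :=
  L2.pull (fun y => IdemLE (y * star y) (x * star x)) (fun y => star x * y) (by
    intro y hy z hz h
    rw [← (idemLE_iff x y).1 hy, ← (idemLE_iff x z).1 hz]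
    exact congrArg (x * ·) h)

open Classical in
theorem leftRegularOp_apply (x : T) (ξ : L2 T) (y : T) :
    leftRegularOp x ξ y = if IdemLE (y * star y) (x * star x) then ξ (star x * y) else 0 := rfl

/-- The operators of the restricted left regular representation:
`λ_r(x) ξ (y) = ξ (x⋆ y)` if `x x⋆ = y y⋆`, and `0` otherwise. -/
def restrictedLeftRegularOp (x : T) : L2 T →L[ℂ] L2 T :=
  L2.pull (fun y => x * star x = y * star y) (fun y => star x * y) (by
    intro y hy z hz h
    rw [← cancel_of_range_eq hy, ← cancel_of_range_eq hz]
    exact congrArg (x * ·) h)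

open Classical in
theorem restrictedLeftRegularOp_apply (x : T) (ξ : L2 T) (y : T) :
    restrictedLeftRegularOp x ξ y = if x * star x = y * star y then ξ (star x * y) else 0 := rfl

theorem idemLE_mul_iff (a b y : T) :
    IdemLE (y * star y) (a * b * star (a * b)) ↔
      IdemLE (y * star y) (a * star a) ∧
        IdemLE (star a * y * star (star a * y)) (b * star b) := by
  rw [idemLE_iff, idemLE_iff, idemLE_iff, star_mul]
  constructor
  · intro h
    have h' : a * (b * (star b * (star a * y))) = y := by
      simpa only [mul_assoc] using h
    have h1 : a * (star a * y) = y := by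
      calc a * (star a * y) = a * (star a * (a * (b * (star b * (star a * y))))) := by rw [h']
        _ = (a * star a * a) * (b * (star b * (star a * y))) := by simp only [mul_assoc]
        _ = y := by rw [mul_star_mul, h']
    refine ⟨h1, ?_⟩
    have hc := idem_comm (idem_source a) (idem_range b)
    calc b * (star b * (star a * y))
        = b * (star b * (star a * (a * (star a * y)))) := by rw [h1]
      _ = (b * star b) * (star a * a) * (star a * y) := by simp only [mul_assoc]
      _ = star a * (a * (b * (star b * (star a * y)))) := by rw [← hc]; simp only [mul_assoc]
      _ = star a * y := by rw [h']
  · rintro ⟨h1, h2⟩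
    calc a * b * (star b * star a * y) = a * (b * (star b * (star a * y))) := by
          simp only [mul_assoc]
      _ = y := by rw [h2, h1]

theorem isRep_leftRegularOp : IsRep (AllPairs T) (leftRegularOp (T := T)) where
  map_mul x y _ := by
    classical
    refine ContinuousLinearMap.ext fun ξ => lp.ext (funext fun z => ?_)
    rw [mul_apply_eq_comp, leftRegularOp_apply, leftRegularOp_apply,
      leftRegularOp_apply]
    have h := idemLE_mul_iff x y z
    by_cases h1 : IdemLE (z * star z) (x * star x)
    · by_cases h2 : IdemLE (star x * z * star (star x * z)) (y * star y)
      · rw [if_pos h1, if_pos h2, if_pos (h.2 ⟨h1, h2⟩), star_mul, mul_assoc]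
      · rw [if_pos h1, if_neg h2, if_neg (fun h3 => h2 (h.1 h3).2)]
    · rw [if_neg h1, if_neg (fun h3 => h1 (h.1 h3).1)]
  map_mul_eq_zero x y h := absurd trivial h
  map_star x := by
    apply L2.star_pull
    · intro y hy
      rw [idemLE_iff] at hy ⊢
      rw [star_star]
      exact ⟨star_cancel x y, hy⟩
    · intro y hy
      rw [idemLE_iff, star_star] at hy
      rw [idemLE_iff, star_star]
      refine ⟨?_, hy⟩
      rw [hy]
  norm_le _ := L2.norm_pull_le

variable (T) in
/-- The left regular representation of `T` on `ℓ²(T)`. -/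
def leftRegular : Rep (AllPairs T) where
  H := L2 T
  π := leftRegularOp
  isRep := isRep_leftRegularOp

theorem isRep_restrictedLeftRegularOp : IsRep (Composable T) (restrictedLeftRegularOp (T := T)) where
  map_mul x y hxy := by
    classical
    refine ContinuousLinearMap.ext fun ξ => lp.ext (funext fun z => ?_)
    rw [mul_apply_eq_comp, restrictedLeftRegularOp_apply,
      restrictedLeftRegularOp_apply, restrictedLeftRegularOp_apply, hxy.range]
    by_cases h1 : x * star x = z * star z
    · have h2 : y * star y = star x * z * star (star x * z) := by
        rw [range_star_mul h1]; exact Eq.symm hxy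
      rw [if_pos h1, if_pos h2, if_pos h1, star_mul, mul_assoc]
    · rw [if_neg h1, if_neg h1]
  map_mul_eq_zero x y hxy := by
    classical
    refine ContinuousLinearMap.ext fun ξ => lp.ext (funext fun z => ?_)
    rw [mul_apply_eq_comp, restrictedLeftRegularOp_apply,
      restrictedLeftRegularOp_apply]
    by_cases h1 : x * star x = z * star z
    · have h2 : ¬ y * star y = star x * z * star (star x * z) := by
        rw [range_star_mul h1]; exact fun h => hxy h.symm
      rw [if_neg h2, ite_self]; rfl
    · rw [if_neg h1]; rfl
  map_star x := by
    apply L2.star_pull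
    · intro y hy
      rw [star_star, range_star_mul hy]
      exact ⟨rfl, cancel_of_range_eq hy⟩
    · intro y hy
      have h1 := range_star_mul hy
      have h2 := cancel_of_range_eq hy
      rw [star_star] at hy h1 h2 ⊢
      exact ⟨h1.symm, h2⟩
  norm_le _ := L2.norm_pull_le

variable (T) in
/-- The restricted left regular representation of `T` on `ℓ²(T)`. -/
def restrictedLeftRegular : Rep (Composable T) where
  H := L2 T
  π := restrictedLeftRegularOp
  isRep := isRep_restrictedLeftRegularOp

end Rep

/-! ### Completion in a C*-seminorm -/

section Completion

/-- A complex `*`-algebra with a submultiplicative seminorm that satisfies the C*-inequality. -/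
class PreCStarAlgebra (A : Type u) extends NonUnitalSeminormedRing A, StarRing A,
    NormedSpace ℂ A, IsScalarTower ℂ A A, SMulCommClass ℂ A A, StarModule ℂ A where
  norm_mul_self_le (a : A) : ‖a‖ * ‖a‖ ≤ ‖star a * a‖

theorem PreCStarAlgebra.norm_star_le {A : Type u} [PreCStarAlgebra A] (a : A) :
    ‖star a‖ ≤ ‖a‖ := by
  have h := (PreCStarAlgebra.norm_mul_self_le (star a)).trans (norm_mul_le _ _)
  rw [star_star] at h
  rcases (norm_nonneg (star a)).eq_or_lt with h0 | h0
  · rw [← h0]; exact norm_nonneg _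
  · exact le_of_mul_le_mul_right h h0

/-- The completion of `A` (the Hausdorff completion: elements of seminorm `0` are identified
with `0`). -/
def CStarCompletion (A : Type u) [PreCStarAlgebra A] : Type u := UniformSpace.Completion A

namespace CStarCompletion

variable {A : Type u} [PreCStarAlgebra A]

instance : NormedAddCommGroup (CStarCompletion A) :=
  inferInstanceAs (NormedAddCommGroup (UniformSpace.Completion A))
instance : NormedSpace ℂ (CStarCompletion A) :=
  inferInstanceAs (NormedSpace ℂ (UniformSpace.Completion A))
instance : CompleteSpace (CStarCompletion A) :=
  inferInstanceAs (CompleteSpace (UniformSpace.Completion A))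

/-- The canonical map into the completion. -/
def ι : A →L[ℂ] CStarCompletion A := UniformSpace.Completion.toComplL

theorem norm_ι (a : A) : ‖ι a‖ = ‖a‖ := UniformSpace.Completion.norm_coe a

theorem isDenseInducing_ι : IsDenseInducing (ι : A → CStarCompletion A) :=
  UniformSpace.Completion.isDenseInducing_coe

theorem denseRange_ι : DenseRange (ι : A → CStarCompletion A) := isDenseInducing_ι.dense

/-- The multiplication, extended by continuity. -/
instance : Mul (CStarCompletion A) where
  mul x y := (isDenseInducing_ι.prodMap isDenseInducing_ι).extend
    (fun p : A × A => ι (p.1 * p.2)) (x, y)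

/-- The involution, extended by continuity. -/
instance : Star (CStarCompletion A) where
  star x := isDenseInducing_ι.extend (fun a : A => ι (star a)) x

theorem continuous_mul' : Continuous fun p : CStarCompletion A × CStarCompletion A => p.1 * p.2 := by
  let j : A →+ CStarCompletion A := AddMonoidHomClass.toAddMonoidHom (ι : A →L[ℂ] _)
  let m : A →+ A →+ CStarCompletion A := (AddMonoidHom.mul : A →+ A →+ A).compr₂ j
  have hm : Continuous fun p : A × A => m p.1 p.2 := ι.continuous.comp continuous_mul
  have di : IsDenseInducing j := isDenseInducing_ι
  have h := di.extend_Z_bilin di hm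
  exact h

instance : ContinuousMul (CStarCompletion A) := ⟨continuous_mul'⟩

theorem ι_mul (a b : A) : ι (a * b) = ι a * ι b :=
  ((isDenseInducing_ι.prodMap isDenseInducing_ι).extend_eq
    (ι.continuous.comp continuous_mul) (a, b)).symm

theorem uniformContinuous_star : UniformContinuous (fun a : A => star a) :=
  AddMonoidHomClass.uniformContinuous_of_bound (starAddEquiv : A ≃+ A) 1
    fun a => by rw [one_mul]; exact PreCStarAlgebra.norm_star_le a

instance : ContinuousStar (CStarCompletion A) where
  continuous_star := by
    have h : UniformContinuous (fun a : A => ι (star a)) :=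
      ι.uniformContinuous.comp uniformContinuous_star
    exact (uniformContinuous_uniformly_extend
      (UniformSpace.Completion.isUniformInducing_coe A) denseRange_ι h).continuous

theorem ι_star (a : A) : ι (star a) = star (ι a) :=
  (isDenseInducing_ι.extend_eq (ι.continuous.comp uniformContinuous_star.continuous) a).symm

theorem induction_on {p : CStarCompletion A → Prop} (x : CStarCompletion A)
    (hp : IsClosed {x | p x}) (h : ∀ a, p (ι a)) : p x :=
  UniformSpace.Completion.induction_on x hp h

theorem induction_on₂ {p : CStarCompletion A → CStarCompletion A → Prop} (x y : CStarCompletion A)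
    (hp : IsClosed {x : CStarCompletion A × CStarCompletion A | p x.1 x.2})
    (h : ∀ a b, p (ι a) (ι b)) : p x y :=
  UniformSpace.Completion.induction_on₂ x y hp h

theorem induction_on₃ {p : CStarCompletion A → CStarCompletion A → CStarCompletion A → Prop}
    (x y z : CStarCompletion A)
    (hp : IsClosed {x : CStarCompletion A × CStarCompletion A × CStarCompletion A |
      p x.1 x.2.1 x.2.2})
    (h : ∀ a b c, p (ι a) (ι b) (ι c)) : p x y z :=
  UniformSpace.Completion.induction_on₃ x y z hp h

instance : NonUnitalRing (CStarCompletion A) where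
  left_distrib x y z := by
    induction x, y, z using induction_on₃ with
    | hp => exact isClosed_eq (by fun_prop) (by fun_prop)
    | h a b c => simp only [← ι_mul, ← map_add, mul_add]
  right_distrib x y z := by
    induction x, y, z using induction_on₃ with
    | hp => exact isClosed_eq (by fun_prop) (by fun_prop)
    | h a b c => simp only [← ι_mul, ← map_add, add_mul]
  zero_mul x := by
    induction x using induction_on with
    | hp => exact isClosed_eq (by fun_prop) (by fun_prop)
    | h a => rw [← map_zero (ι : A →L[ℂ] CStarCompletion A), ← ι_mul, zero_mul]
  mul_zero x := by
    induction x using induction_on with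
    | hp => exact isClosed_eq (by fun_prop) (by fun_prop)
    | h a => rw [← map_zero (ι : A →L[ℂ] CStarCompletion A), ← ι_mul, mul_zero]
  mul_assoc x y z := by
    induction x, y, z using induction_on₃ with
    | hp => exact isClosed_eq (by fun_prop) (by fun_prop)
    | h a b c => simp only [← ι_mul, mul_assoc]

instance : NonUnitalNormedRing (CStarCompletion A) where
  dist_eq := dist_eq_norm_neg_add
  norm_mul_le x y := by
    induction x, y using induction_on₂ with
    | hp => exact isClosed_le (by fun_prop) (by fun_prop)
    | h a b =>
      rw [← ι_mul, norm_ι, norm_ι, norm_ι]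
      exact norm_mul_le a b

instance : StarRing (CStarCompletion A) where
  star_involutive x := by
    induction x using induction_on with
    | hp => exact isClosed_eq (by fun_prop) (by fun_prop)
    | h a => rw [← ι_star, ← ι_star, star_star]
  star_add x y := by
    induction x, y using induction_on₂ with
    | hp => exact isClosed_eq (by fun_prop) (by fun_prop)
    | h a b => simp only [← ι_star, ← map_add, star_add]
  star_mul x y := by
    induction x, y using induction_on₂ with
    | hp => exact isClosed_eq (by fun_prop) (by fun_prop)
    | h a b => simp only [← ι_star, ← ι_mul, star_mul]

instance : IsScalarTower ℂ (CStarCompletion A) (CStarCompletion A) where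
  smul_assoc c x y := by
    rw [smul_eq_mul, smul_eq_mul]
    induction x, y using induction_on₂ with
    | hp =>
      have h1 : Continuous fun x : CStarCompletion A × CStarCompletion A => (c • x.1) * x.2 :=
        (continuous_fst.const_smul c).mul continuous_snd
      have h2 : Continuous fun x : CStarCompletion A × CStarCompletion A => c • (x.1 * x.2) :=
        (continuous_fst.mul continuous_snd).const_smul c
      exact isClosed_eq h1 h2
    | h a b => rw [← ι_mul, ← map_smul, ← map_smul, ← ι_mul, smul_mul_assoc]

instance : SMulCommClass ℂ (CStarCompletion A) (CStarCompletion A) where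
  smul_comm c x y := by
    rw [smul_eq_mul, smul_eq_mul]
    induction x, y using induction_on₂ with
    | hp =>
      have h1 : Continuous fun x : CStarCompletion A × CStarCompletion A => c • (x.1 * x.2) :=
        (continuous_fst.mul continuous_snd).const_smul c
      have h2 : Continuous fun x : CStarCompletion A × CStarCompletion A => x.1 * (c • x.2) :=
        continuous_fst.mul (continuous_snd.const_smul c)
      exact isClosed_eq h1 h2
    | h a b => rw [← ι_mul, ← map_smul, ← map_smul, ← ι_mul, mul_smul_comm]

instance : StarModule ℂ (CStarCompletion A) where
  star_smul c x := by
    induction x using induction_on with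
    | hp =>
      have h1 : Continuous fun x : CStarCompletion A => star (c • x) :=
        (continuous_id.const_smul c).star
      have h2 : Continuous fun x : CStarCompletion A => star c • star x :=
        (continuous_const_smul (star c)).comp continuous_star
      exact isClosed_eq h1 h2
    | h a => rw [← ι_star, ← map_smul, ← map_smul, ← ι_star, star_smul]

instance : CStarRing (CStarCompletion A) where
  norm_mul_self_le x := by
    induction x using induction_on with
    | hp => exact isClosed_le (by fun_prop) (by fun_prop)
    | h a =>
      rw [← ι_star, ← ι_mul, norm_ι, norm_ι]
      exact PreCStarAlgebra.norm_mul_self_le a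

instance : NonUnitalCStarAlgebra (CStarCompletion A) where

end CStarCompletion

end Completion

/-! ### The C*-algebra of a family of representations -/

section FamilyNorm

variable {T : Type u} [Semigroup T] [InverseSemigroup T] {D : T → T → Prop}

/-- `‖f‖_F = sup {‖π̃ f‖ : π ∈ F}`. -/
def repNorm (F : Set (Rep D)) (f : L1 D) : ℝ := ⨆ ρ : F, ‖ρ.1.tilde f‖

section

variable (F : Set (Rep D))

theorem le_repNorm {ρ : Rep D} (hρ : ρ ∈ F) (f : L1 D) : ‖ρ.tilde f‖ ≤ repNorm F f :=
  le_ciSup (f := fun ρ : F => ‖ρ.1.tilde f‖)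
    ⟨‖f‖, by rintro _ ⟨ρ, rfl⟩; exact ρ.1.norm_tilde_le f⟩ ⟨ρ, hρ⟩

theorem repNorm_le {f : L1 D} {C : ℝ} (hC : 0 ≤ C) (h : ∀ ρ ∈ F, ‖ρ.tilde f‖ ≤ C) :
    repNorm F f ≤ C := Real.iSup_le (fun ρ => h ρ.1 ρ.2) hC

theorem repNorm_nonneg (f : L1 D) : 0 ≤ repNorm F f := Real.iSup_nonneg fun _ => norm_nonneg _

theorem repNorm_mul_le (f g : L1 D) : repNorm F (f * g) ≤ repNorm F f * repNorm F g := by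
  refine repNorm_le F (mul_nonneg (repNorm_nonneg F f) (repNorm_nonneg F g)) fun ρ hρ => ?_
  rw [ρ.tilde_mul]
  exact (norm_mul_le _ _).trans (mul_le_mul (le_repNorm F hρ f) (le_repNorm F hρ g)
    (norm_nonneg _) (repNorm_nonneg F f))

theorem repNorm_mul_self_le (f : L1 D) : repNorm F f * repNorm F f ≤ repNorm F (star f * f) := by
  have h : ∀ ρ ∈ F, ‖ρ.tilde f‖ ≤ √(repNorm F (star f * f)) := fun ρ hρ => by
    apply Real.le_sqrt_of_sq_le
    rw [sq, ← CStarRing.norm_star_mul_self, ← ρ.tilde_star, ← ρ.tilde_mul]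
    exact le_repNorm F hρ _
  have h2 := repNorm_le F (Real.sqrt_nonneg _) h
  calc repNorm F f * repNorm F f ≤ √(repNorm F (star f * f)) * √(repNorm F (star f * f)) :=
        mul_le_mul h2 h2 (repNorm_nonneg F f) (Real.sqrt_nonneg _)
    _ = _ := Real.mul_self_sqrt (repNorm_nonneg F _)

theorem repNorm_singleton (ρ : Rep D) (f : L1 D) : repNorm {ρ} f = ‖ρ.tilde f‖ := ciSup_unique

/-- `repNorm` as a seminorm. -/
def repSeminorm : Seminorm ℂ (L1 D) :=
  Seminorm.of (repNorm F)
    (fun f g => repNorm_le F (add_nonneg (repNorm_nonneg F f) (repNorm_nonneg F g)) fun ρ hρ => by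
      rw [ρ.tilde_add]
      exact (norm_add_le _ _).trans (add_le_add (le_repNorm F hρ f) (le_repNorm F hρ g)))
    (fun c f => by
      have : (fun ρ : F => ‖ρ.1.tilde (c • f)‖) = fun ρ : F => ‖c‖ * ‖ρ.1.tilde f‖ := by
        funext ρ; rw [ρ.1.tilde_smul, norm_smul]
      rw [repNorm, this, ← Real.mul_iSup_of_nonneg (norm_nonneg c)]; rfl)

/-- The algebra `L1 D` with the seminorm `repNorm F`. -/
def Normed (_ : Set (Rep D)) : Type u := L1 D

end

variable {F : Set (Rep D)}

/-- An element of `L1 D`, regarded as an element of the algebra with the seminorm `repNorm F`. -/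
def toNormed (F : Set (Rep D)) (f : L1 D) : Normed F := f

variable [IsProductDomain D]

instance : NonUnitalRing (Normed F) := L1.nonUnitalRing
instance : StarRing (Normed F) := L1.starRing
instance : Module ℂ (Normed F) := inferInstanceAs (Module ℂ (L1 D))
instance : IsScalarTower ℂ (Normed F) (Normed F) := inferInstanceAs (IsScalarTower ℂ (L1 D) (L1 D))
instance : SMulCommClass ℂ (Normed F) (Normed F) := inferInstanceAs (SMulCommClass ℂ (L1 D) (L1 D))
instance : StarModule ℂ (Normed F) := inferInstanceAs (StarModule ℂ (L1 D))

instance : SeminormedAddCommGroup (Normed F) :=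
  (repSeminorm F).toAddGroupSeminorm.toSeminormedAddCommGroup

theorem norm_toNormed (f : L1 D) : ‖toNormed F f‖ = repNorm F f := rfl

instance : NonUnitalSeminormedRing (Normed F) where
  dist_eq := dist_eq_norm_neg_add
  norm_mul_le f g := repNorm_mul_le F f g

instance : PreCStarAlgebra (Normed F) where
  norm_smul_le c f := ((repSeminorm F).smul' c f).le
  norm_mul_self_le f := repNorm_mul_self_le F f

/-- The completion of the algebra `L1 D` in the norm `f ↦ sup {‖π̃ f‖ : π ∈ F}`. -/
abbrev CStar (F : Set (Rep D)) : Type u := CStarCompletion (Normed F)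

/-- The canonical map of `L1 D` into its completion. -/
def CStar.of (F : Set (Rep D)) (f : L1 D) : CStar F := CStarCompletion.ι (toNormed F f)

theorem CStar.norm_of (F : Set (Rep D)) (f : L1 D) : ‖CStar.of F f‖ = repNorm F f :=
  CStarCompletion.norm_ι (toNormed F f)

end FamilyNorm

section Algebras

variable (T : Type u) [Semigroup T] [InverseSemigroup T]

/-- The full C*-algebra `C*(T)`: the completion of `ℓ¹(T)` in the supremum over all
representations of `T`. -/
abbrev FullCStar : Type u := CStar (Set.univ : Set (Rep (AllPairs T)))

/-- The reduced C*-algebra of `T`: the completion of `ℓ¹(T)` in the norm given by the left regular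
representation. -/
abbrev ReducedCStar : Type u := CStar {leftRegular T}

/-- The restricted full C*-algebra: the completion of the restricted semigroup algebra in the
supremum over all restricted representations. -/
abbrev RestrictedFullCStar : Type u := CStar (Set.univ : Set (Rep (Composable T)))

/-- The restricted reduced C*-algebra: the completion of the restricted semigroup algebra in the
norm given by the restricted left regular representation. -/
abbrev RestrictedReducedCStar : Type u := CStar {restrictedLeftRegular T}

end Algebras

/-! ### Quotients by closed ideals -/

section Quotient

/-- A closed two-sided `*`-ideal of a C*-algebra. -/
structure ClosedIdeal (B : Type u) [NonUnitalCStarAlgebra B] extends Submodule ℂ B where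
  mul_mem_left (x : B) {y : B} : y ∈ carrier → x * y ∈ carrier
  mul_mem_right {x : B} (y : B) : x ∈ carrier → x * y ∈ carrier
  star_mem {x : B} : x ∈ carrier → star x ∈ carrier
  isClosed : IsClosed carrier

namespace ClosedIdeal

variable {B : Type u} [NonUnitalCStarAlgebra B]

/-- The quotient `B ⧸ J`, with the quotient norm `‖[b]‖ = inf {‖b + j‖ : j ∈ J}`. -/
def Quot (J : ClosedIdeal B) : Type u := B ⧸ J.toSubmodule

variable {J : ClosedIdeal B}

instance : NormedAddCommGroup J.Quot :=
  haveI : IsClosed (J.toSubmodule : Set B) := J.isClosed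
  inferInstanceAs (NormedAddCommGroup (B ⧸ J.toSubmodule))

instance : NormedSpace ℂ J.Quot :=
  haveI : IsClosed (J.toSubmodule : Set B) := J.isClosed
  inferInstanceAs (NormedSpace ℂ (B ⧸ J.toSubmodule))

variable (J) in
/-- The quotient map. -/
def proj : B →ₗ[ℂ] J.Quot := J.toSubmodule.mkQ

theorem proj_surjective : Function.Surjective J.proj := J.toSubmodule.mkQ_surjective

theorem proj_eq_proj {x y : B} : J.proj x = J.proj y ↔ x - y ∈ J.toSubmodule :=
  Submodule.Quotient.eq _

theorem norm_proj (x : B) : ‖J.proj x‖ = Metric.infDist x (J.toSubmodule : Set B) :=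
  QuotientAddGroup.norm_mk (S := J.toSubmodule.toAddSubgroup) x

instance : Mul J.Quot where
  mul := Quotient.map₂ (· * ·) (by
    intro a b hab c d hcd
    have hab := (Submodule.quotientRel_def _).1 hab
    have hcd := (Submodule.quotientRel_def _).1 hcd
    refine (Submodule.quotientRel_def _).2 ?_
    have e : a * c - b * d = (a - b) * c + b * (c - d) := by rw [sub_mul, mul_sub]; abel
    rw [e]
    exact J.toSubmodule.add_mem (J.mul_mem_right _ hab) (J.mul_mem_left _ hcd))

instance : Star J.Quot where
  star := Quotient.map star (by
    intro a b hab
    have hab := (Submodule.quotientRel_def _).1 hab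
    refine (Submodule.quotientRel_def _).2 ?_
    rw [← star_sub]
    exact J.star_mem hab)

theorem proj_mul (x y : B) : J.proj (x * y) = J.proj x * J.proj y := rfl
theorem proj_star (x : B) : J.proj (star x) = star (J.proj x) := rfl

instance : NonUnitalRing J.Quot where
  left_distrib x y z := by
    obtain ⟨x, rfl⟩ := proj_surjective x
    obtain ⟨y, rfl⟩ := proj_surjective y
    obtain ⟨z, rfl⟩ := proj_surjective z
    simp only [← proj_mul, ← map_add, mul_add]
  right_distrib x y z := by
    obtain ⟨x, rfl⟩ := proj_surjective x
    obtain ⟨y, rfl⟩ := proj_surjective y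
    obtain ⟨z, rfl⟩ := proj_surjective z
    simp only [← proj_mul, ← map_add, add_mul]
  zero_mul x := by
    obtain ⟨x, rfl⟩ := proj_surjective x
    rw [← map_zero J.proj, ← proj_mul, zero_mul]
  mul_zero x := by
    obtain ⟨x, rfl⟩ := proj_surjective x
    rw [← map_zero J.proj, ← proj_mul, mul_zero]
  mul_assoc x y z := by
    obtain ⟨x, rfl⟩ := proj_surjective x
    obtain ⟨y, rfl⟩ := proj_surjective y
    obtain ⟨z, rfl⟩ := proj_surjective z
    simp only [← proj_mul, mul_assoc]

instance : StarRing J.Quot where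
  star_involutive x := by
    obtain ⟨x, rfl⟩ := proj_surjective x
    rw [← proj_star, ← proj_star, star_star]
  star_add x y := by
    obtain ⟨x, rfl⟩ := proj_surjective x
    obtain ⟨y, rfl⟩ := proj_surjective y
    simp only [← proj_star, ← map_add, star_add]
  star_mul x y := by
    obtain ⟨x, rfl⟩ := proj_surjective x
    obtain ⟨y, rfl⟩ := proj_surjective y
    simp only [← proj_star, ← proj_mul, star_mul]

end ClosedIdeal

end Quotient

/-! ### The ideal spanned by the point mass at zero, and the restriction map -/

section Main

variable {S : Type u} [Semigroup S] [InverseSemigroup S]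

open RestrictedSemigroup

theorem mul_delta_zero (f : L1 (AllPairs (RestrictedSemigroup S))) :
    ∃ c : ℂ, f * L1.delta _ zero = c • L1.delta _ zero := by
  classical
  refine ⟨(L1.lift (fun _ => (1 : ℂ)) (fun _ => by simp)) f, ?_⟩
  rw [L1.mul_eq]
  have : (L1.mulL (AllPairs (RestrictedSemigroup S))).flip (L1.delta _ zero) =
      (L1.lift (fun _ => (1 : ℂ)) (fun _ => by simp)).smulRight (L1.delta _ zero) := by
    refine L1.clm_ext fun x => ?_
    rw [ContinuousLinearMap.flip_apply, L1.mulL_delta, ContinuousLinearMap.smulRight_apply,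
      L1.lift_delta, mul_zero', one_smul]
    exact if_pos trivial
  exact DFunLike.congr_fun this f

theorem star_delta_zero :
    star (L1.delta (AllPairs (RestrictedSemigroup S)) zero) = L1.delta _ zero := by
  classical
  refine L1.ext fun x => ?_
  rw [L1.star_apply, L1.delta_apply, L1.delta_apply]
  rcases x with _ | x <;> simp

/-- The image of `δ₀` in the completion. -/
abbrev deltaZero (F : Set (Rep (AllPairs (RestrictedSemigroup S)))) : CStar F :=
  CStar.of F (L1.delta _ zero)

theorem mul_mem_zeroIdeal (F : Set (Rep (AllPairs (RestrictedSemigroup S)))) (x : CStar F)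
    {y : CStar F} (hy : y ∈ Submodule.span ℂ {deltaZero F}) :
    x * y ∈ Submodule.span ℂ {deltaZero F} := by
  have hc : IsClosed (Submodule.span ℂ {deltaZero F} : Set (CStar F)) :=
    Submodule.closed_of_finiteDimensional _
  obtain ⟨c, rfl⟩ := Submodule.mem_span_singleton.1 hy
  rw [mul_smul_comm]
  refine Submodule.smul_mem _ _ ?_
  induction x using CStarCompletion.induction_on with
  | hp => exact hc.preimage (f := fun x => x * deltaZero F) (by fun_prop)
  | h f =>
    obtain ⟨c, h⟩ := mul_delta_zero f
    refine Submodule.mem_span_singleton.2 ⟨c, ?_⟩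
    rw [deltaZero, CStar.of, ← CStarCompletion.ι_mul, ← map_smul]
    exact congrArg (fun g => CStarCompletion.ι (toNormed F g)) h.symm

theorem star_mem_zeroIdeal (F : Set (Rep (AllPairs (RestrictedSemigroup S))))
    {x : CStar F} (hx : x ∈ Submodule.span ℂ {deltaZero F}) :
    star x ∈ Submodule.span ℂ {deltaZero F} := by
  obtain ⟨c, rfl⟩ := Submodule.mem_span_singleton.1 hx
  rw [star_smul]
  refine Submodule.smul_mem _ _ (Submodule.mem_span_singleton.2 ⟨1, ?_⟩)
  rw [one_smul, deltaZero, CStar.of, ← CStarCompletion.ι_star]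
  exact congrArg (fun g => CStarCompletion.ι (toNormed F g)) star_delta_zero.symm

/-- The ideal `ℂ δ₀`, spanned by the point mass at the zero of the restricted semigroup. -/
def zeroIdeal (F : Set (Rep (AllPairs (RestrictedSemigroup S)))) : ClosedIdeal (CStar F) where
  toSubmodule := Submodule.span ℂ {deltaZero F}
  mul_mem_left x _ hy := mul_mem_zeroIdeal F x hy
  mul_mem_right {x} y hx := by
    have h := star_mem_zeroIdeal F (mul_mem_zeroIdeal F (star y) (star_mem_zeroIdeal F hx))
    rwa [star_mul, star_star, star_star] at h
  star_mem hx := star_mem_zeroIdeal F hx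
  isClosed := Submodule.closed_of_finiteDimensional _

/-- The restriction of functions on `S ∪ {0}` to `S`. -/
def restrict (f : L1 (AllPairs (RestrictedSemigroup S))) : L1 (Composable S) :=
  L1.mk (fun x => f (of x)) ((L1.summable_norm f).comp_injective fun x y h => by
    cases h; rfl)

end Main

end RestrictedAlgebra

end

noncomputable section

namespace RestrictedAlgebra

universe u

variable {S : Type u} [Semigroup S] [InverseSemigroup S]

open RestrictedSemigroup

/-! ### Restriction of functions as a `*`-homomorphism of `ℓ¹` algebras -/

namespace RestrictedSemigroup

/-! The new element `0` is absorbing and self-adjoint in `S ∪ {0}`. Hence for any representation `π`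
of `S ∪ {0}` the operator `P = π 0` is a projection with `π x * P = P = P * π x`. It reduces `π`: on
the range of `P` every `π x` acts as the identity, and on the complement `x ↦ π x - P` sends `0` to
`0`, which makes it a restricted representation of `S`. Integrating over `f` gives `π̃ f = (∑ x, f
x) • P + σ̃ (f|S)`, where `σ x = π x - P` (`Rep.tilde_corner`). Conversely, a restricted
representation of `S` becomes a representation of `S ∪ {0}` once it is extended by the value `0`
(`Rep.tilde_extendZero`).

The left regular representation shows the same splitting on `ℓ²(S ∪ {0}) = ℂ ⊕ ℓ²(S)`. Nonzero
idempotents of `S ∪ {0}` are comparable only when equal (`idemLE_of_iff`), so the condition defining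
`Λ` on `ℓ²(S)` becomes the one defining `λ_r`, while `Λ 0` is the projection onto the coordinate `0`
(`tilde_restrictedLeftRegular`, `tilde_leftRegular`).

In both cases this yields two estimates between the norm of a family `F` on `ℓ¹(S ∪ {0})` and that
of a family `G` on `ℓ¹_r(S)`: restriction to `S` is contractive, and `‖f‖_F ≤ ‖f|S‖_G` whenever `∑
x, f x = 0`. They suffice (`exists_quot_starAlgEquiv`). Restriction is a `*`-homomorphism killing
`δ₀`, so it extends to the completions and drops to the quotient by `ℂ δ₀` as a contraction. Every
`f` is congruent modulo `ℂ δ₀` to `f - (∑ x, f x) • δ₀`, whose values sum to zero, so the second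
estimate bounds the quotient norm from above. The resulting isometry has closed range containing a
dense set, so it is onto. -/

theorem of_injective {S : Type u} : Function.Injective (of : S → RestrictedSemigroup S) :=
  fun x y h => by
  cases h; rfl

/-- Distinct idempotents of `S` have product `0` in the restricted semigroup: two idempotents `e`,
`f` are composable only if `e = f`. The natural order is therefore trivial away from `0`, which is
what turns the support condition of `Λ` into that of `λ_r`. -/
theorem idemLE_of_iff (x y : S) :
    IdemLE (of y * star (of y)) (of x * star (of x)) ↔ x * star x = y * star y := by
  have hc (z : S) : Composable S z (star z) := by simp [Composable]
  have hi (z : S) : star (z * star z) * (z * star z) = z * star z := by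
    rw [(hc z).source, star_star]
  have hr (z : S) : z * star z * star (z * star z) = z * star z := (hc z).range
  have h : Composable S (y * star y) (x * star x) ↔ x * star x = y * star y := by
    rw [Composable, hi, hr, eq_comm]
  rw [IdemLE, star_of, star_of, of_mul_of, of_mul_of, if_pos (hc y), if_pos (hc x), of_mul_of]
  by_cases hxy : x * star x = y * star y
  · rw [if_pos (h.2 hxy), hxy, idem_range]
    simp
  · rw [if_neg (mt h.1 hxy)]
    simp [hxy]

theorem idemLE_zero (x : RestrictedSemigroup S) :
    IdemLE ((zero : RestrictedSemigroup S) * star zero) (x * star x) := rfl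

theorem not_idemLE_zero (y : S) :
    ¬ IdemLE (of y * star (of y)) ((zero : RestrictedSemigroup S) * star zero) := by
  have hc : Composable S y (star y) := by simp [Composable]
  rw [IdemLE, star_of, of_mul_of, if_pos hc, zero_mul', mul_zero']
  simp

end RestrictedSemigroup

/-- `restrict` as a contraction. -/
def restrictL : L1 (AllPairs (RestrictedSemigroup S)) →L[ℂ] L1 (Composable S) :=
  LinearMap.mkContinuous
    { toFun := restrict
      map_add' := fun _ _ => rfl
      map_smul' := fun _ _ => rfl } 1 fun f => by
    rw [one_mul, L1.norm_eq, L1.norm_eq]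
    exact tsum_comp_le_tsum_of_inj (L1.summable_norm f) (fun _ => norm_nonneg _) of_injective

theorem restrictL_apply (f : L1 (AllPairs (RestrictedSemigroup S))) :
    restrictL f = restrict f := rfl

theorem restrict_delta_of (x : S) : restrict (L1.delta _ (of x)) = L1.delta _ x := by
  classical
  refine L1.ext fun y => ?_
  change L1.delta (AllPairs (RestrictedSemigroup S)) (of x) (of y) = _
  simp [L1.delta_apply]

theorem restrict_delta_zero : restrict (L1.delta _ (zero : RestrictedSemigroup S)) = 0 := by
  classical
  refine L1.ext fun y => ?_
  change L1.delta (AllPairs (RestrictedSemigroup S)) zero (of y) = 0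
  simp [L1.delta_apply]

/-- Both products are determined by point masses, by linearity and continuity in each variable. A
pair that is not composable contributes a multiple of `δ₀` to the convolution on `S ∪ {0}`, and
restriction kills it, just as the restricted product drops such pairs. -/
theorem restrict_mul (f g : L1 (AllPairs (RestrictedSemigroup S))) :
    restrict (f * g) = restrict f * restrict g := by
  classical
  have h2 (s) (g : L1 (AllPairs (RestrictedSemigroup S))) :
      restrictL (L1.mulL _ (L1.delta _ s) g) =
        L1.mulL _ (restrictL (L1.delta _ s)) (restrictL g) := by
    have : restrictL.comp (L1.mulL _ (L1.delta _ s)) =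
        (L1.mulL _ (restrictL (L1.delta _ s))).comp (restrictL (S := S)) := by
      refine L1.clm_ext fun t => ?_
      rw [ContinuousLinearMap.comp_apply, ContinuousLinearMap.comp_apply, L1.mulL_delta,
        if_pos (by trivial), restrictL_apply, restrictL_apply, restrictL_apply]
      rcases s with _ | s
      · rw [zero_mul', restrict_delta_zero, map_zero, _root_.zero_apply]
      rcases t with _ | t
      · rw [mul_zero', restrict_delta_zero, map_zero]
      rw [restrict_delta_of, restrict_delta_of, L1.mulL_delta, of_mul_of]
      split_ifs
      · exact restrict_delta_of _
      · exact restrict_delta_zero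
    exact DFunLike.congr_fun this g
  have h1 : restrictL.comp ((L1.mulL _).flip g) =
      ((L1.mulL _).flip (restrictL g)).comp (restrictL (S := S)) :=
    L1.clm_ext fun s => h2 s g
  rw [L1.mul_eq, L1.mul_eq]
  exact DFunLike.congr_fun h1 f

theorem restrict_star (f : L1 (AllPairs (RestrictedSemigroup S))) :
    restrict (star f) = star (restrict f) := rfl

theorem restrict_surjective : Function.Surjective (restrict (S := S)) := fun g => by
  -- Extension by the value `0` at the new point; it is supported on the range of `of`, so
  -- summability is inherited from `g`.
  refine ⟨L1.mk (fun x => RestrictedSemigroup.casesOn x 0 g) ?_, rfl⟩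
  refine (of_injective.summable_iff ?_).1 (L1.summable_norm g)
  rintro (_ | x) hx
  · exact norm_zero
  · exact absurd ⟨x, rfl⟩ hx

/-- The augmentation `f ↦ ∑ x, f x`. -/
def augmentation : L1 (AllPairs (RestrictedSemigroup S)) →L[ℂ] ℂ :=
  L1.lift (fun _ => (1 : ℂ)) fun _ => by simp

theorem augmentation_delta (x : RestrictedSemigroup S) : augmentation (L1.delta _ x) = 1 :=
  L1.lift_delta _ _ x

/-- A bounded linear map on `ℓ¹(S ∪ {0})` that vanishes at `δ₀` factors through `restrict`. -/
theorem apply_lift_restrict {E E' : Type*} [NormedAddCommGroup E] [NormedSpace ℂ E]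
    [CompleteSpace E] [NormedAddCommGroup E'] [NormedSpace ℂ E'] (φ : S → E)
    (hφ : ∀ x, ‖φ x‖ ≤ 1) (A : E →L[ℂ] E')
    (B : L1 (AllPairs (RestrictedSemigroup S)) →L[ℂ] E') (h0 : B (L1.delta _ zero) = 0)
    (h : ∀ x, B (L1.delta _ (of x)) = A (φ x)) (f : L1 (AllPairs (RestrictedSemigroup S))) :
    A (L1.lift φ hφ (restrict f)) = B f := by
  have : (A.comp (L1.lift φ hφ)).comp restrictL = B := by
    refine L1.clm_ext fun x => ?_
    change A (L1.lift φ hφ (restrict _)) = _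
    rcases x with _ | x
    · rw [restrict_delta_zero, map_zero, map_zero, h0]
    · rw [restrict_delta_of, L1.lift_delta, h]
  exact DFunLike.congr_fun this f

/-! ### Restricted representations of `S` and representations of the restricted semigroup -/

/-- A restricted representation, extended by `π 0 = 0`. -/
def Rep.extendZero (σ : Rep (Composable S)) : Rep (AllPairs (RestrictedSemigroup S)) where
  H := σ.H
  π x := RestrictedSemigroup.casesOn x 0 σ.π
  isRep :=
    { map_mul := by
        rintro (_ | x) (_ | y) -
        · exact zero_mul _
        · exact zero_mul _
        · exact mul_zero _
        · rw [of_mul_of]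
          split_ifs with h
          · exact σ.isRep.map_mul x y h
          · exact σ.isRep.map_mul_eq_zero x y h
      map_mul_eq_zero := fun _ _ h => absurd trivial h
      map_star := by
        rintro (_ | x)
        · exact (star_zero _).symm
        · exact σ.isRep.map_star x
      norm_le := by
        rintro (_ | x)
        · exact norm_zero.trans_le zero_le_one
        · exact σ.isRep.norm_le x }

/-- Every restricted representation is thus already tested by the universal norm on `ℓ¹(S ∪ {0})`,
which makes restriction contractive for the universal norms. -/
theorem Rep.tilde_extendZero (σ : Rep (Composable S))
    (f : L1 (AllPairs (RestrictedSemigroup S))) :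
    σ.extendZero.tilde f = σ.tilde (restrict f) :=
  (apply_lift_restrict σ.π σ.isRep.norm_le (.id ℂ _)
    (L1.lift σ.extendZero.π σ.extendZero.isRep.norm_le) (L1.lift_delta _ _ _)
    (fun _ => L1.lift_delta _ _ _) f).symm

/-! ### Splitting a representation along the projection `π 0` -/

section Corner

variable (ρ : Rep (AllPairs (RestrictedSemigroup S)))

/-- Together with `zero_mul_eq` this says that `π 0` reduces `π` and that `π` is trivial on its
range; the case `x = 0` makes `π 0` idempotent. -/
theorem Rep.mul_zero_eq (x : RestrictedSemigroup S) : ρ.π x * ρ.π zero = ρ.π zero := by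
  rw [ρ.isRep.map_mul _ _ trivial, mul_zero']

theorem Rep.zero_mul_eq (x : RestrictedSemigroup S) : ρ.π zero * ρ.π x = ρ.π zero := by
  rw [ρ.isRep.map_mul _ _ trivial, zero_mul']

/-- The operator `1 - π 0` is a projection, so by the C*-identity its norm `t` satisfies `t = t²`.
-/
theorem Rep.norm_one_sub_zero_le : ‖1 - ρ.π zero‖ ≤ 1 := by
  have h : star (1 - ρ.π zero) * (1 - ρ.π zero) = 1 - ρ.π zero := by
    rw [star_sub, star_one, ← ρ.isRep.map_star, star_zero', mul_sub, mul_one, sub_mul, one_mul,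
      ρ.mul_zero_eq, sub_self, sub_zero]
  have h2 := CStarRing.norm_star_mul_self (x := 1 - ρ.π zero)
  rw [h] at h2
  nlinarith [norm_nonneg (1 - ρ.π zero)]

/-- The restricted representation `x ↦ π x - π 0`. -/
def Rep.corner : Rep (Composable S) where
  H := ρ.H
  π x := ρ.π (of x) - ρ.π zero
  isRep :=
    { map_mul := fun x y h => by
        -- All three terms containing `P = π 0` equal `P`, so the product of the differences is `π
        -- (x • y) - P`. For a composable pair this is the value at `x y`; otherwise it is `P - P =
        -- 0`.
        rw [mul_sub, sub_mul, sub_mul, ρ.mul_zero_eq, ρ.mul_zero_eq, ρ.zero_mul_eq,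
          ρ.isRep.map_mul _ _ trivial, of_mul_of, if_pos h, sub_self, sub_zero]
      map_mul_eq_zero := fun x y h => by
        rw [mul_sub, sub_mul, sub_mul, ρ.mul_zero_eq, ρ.mul_zero_eq, ρ.zero_mul_eq,
          ρ.isRep.map_mul _ _ trivial, of_mul_of, if_neg h, sub_self]
      map_star := fun x => by
        rw [star_sub, ← ρ.isRep.map_star, ← ρ.isRep.map_star]; rfl
      norm_le := fun x => by
        have h : ρ.π (of x) - ρ.π zero = ρ.π (of x) * (1 - ρ.π zero) := by
          -- Contractivity is not visible from the difference, but it is from the factorization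
          -- through the projection `1 - π 0`.
          rw [mul_sub, mul_one, ρ.mul_zero_eq]
        rw [h]
        exact (norm_mul_le _ _).trans
          (mul_le_one₀ (ρ.isRep.norm_le _) (norm_nonneg _) ρ.norm_one_sub_zero_le) }

/-- The right side vanishes at `δ₀`, where the augmentation is `1`, so it depends only on `f|S` and
can be compared on the remaining point masses. When the augmentation of `f` is zero, `π̃ f` itself
is a value of a restricted representation. -/
theorem Rep.tilde_corner (f : L1 (AllPairs (RestrictedSemigroup S))) :
    ρ.corner.tilde (restrict f) = ρ.tilde f - augmentation f • ρ.π zero := by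
  have h := apply_lift_restrict (fun x => ρ.π (of x) - ρ.π zero) ρ.corner.isRep.norm_le
    (.id ℂ _) (ρ.tildeL - augmentation.smulRight (ρ.π zero))
    (by
      rw [_root_.sub_apply, ContinuousLinearMap.smulRight_apply, augmentation_delta, one_smul,
        ρ.tildeL_apply, ρ.tilde_delta, sub_self])
    (fun x => by
      rw [_root_.sub_apply, ContinuousLinearMap.smulRight_apply, augmentation_delta, one_smul,
        ρ.tildeL_apply, ρ.tilde_delta]
      rfl) f
  rw [_root_.sub_apply, ContinuousLinearMap.smulRight_apply, ρ.tildeL_apply] at h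
  exact h

end Corner

/-! ### Comparison of the universal norms -/

theorem repNorm_restrict_le_univ (f : L1 (AllPairs (RestrictedSemigroup S))) :
    repNorm Set.univ (restrict f) ≤ repNorm Set.univ f :=
  repNorm_le _ (repNorm_nonneg _ _) fun σ _ => by
    rw [← σ.tilde_extendZero]
    exact le_repNorm _ (Set.mem_univ _) f

theorem repNorm_le_restrict_univ (f : L1 (AllPairs (RestrictedSemigroup S)))
    (hf : augmentation f = 0) : repNorm Set.univ f ≤ repNorm Set.univ (restrict f) :=
  repNorm_le _ (repNorm_nonneg _ _) fun ρ _ => by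
    have h := ρ.tilde_corner f
    rw [hf, zero_smul, sub_zero] at h
    rw [← h]
    exact le_repNorm _ (Set.mem_univ _) _

/-! ### The regular representations -/

namespace L2

/-- Restriction of functions from `S ∪ {0}` to `S`. -/
def restrictL : L2 (RestrictedSemigroup S) →L[ℂ] L2 S :=
  LinearMap.mkContinuous
    { toFun := fun ξ => ⟨fun x => ξ (of x),
        memℓp_gen ((L2.summable_sq ξ).comp_injective of_injective)⟩
      map_add' := fun _ _ => rfl
      map_smul' := fun _ _ => rfl } 1 fun ξ => by
    rw [one_mul]
    refine lp.norm_le_of_tsum_le (by simp) (norm_nonneg _) ?_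
    rw [lp.norm_rpow_eq_tsum (by simp)]
    exact tsum_comp_le_tsum_of_inj (L2.summable_sq ξ) (fun _ => by positivity) of_injective

/-- Extension of functions on `S` to `S ∪ {0}` by the value `0`. -/
def extendL : L2 S →L[ℂ] L2 (RestrictedSemigroup S) :=
  LinearMap.mkContinuous
    { toFun := fun ξ => ⟨fun x => RestrictedSemigroup.casesOn x 0 ξ, memℓp_gen <| by
        refine (of_injective.summable_iff ?_).1 (L2.summable_sq ξ)
        rintro (_ | x) hx
        · simp
        · exact absurd ⟨x, rfl⟩ hx⟩
      map_add' := fun _ _ => lp.ext <| funext <| by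
        rintro (_ | x)
        · exact (add_zero _).symm
        · rfl
      map_smul' := fun _ _ => lp.ext <| funext <| by
        rintro (_ | x)
        · exact (mul_zero _).symm
        · rfl } 1 fun ξ => by
    rw [one_mul]
    refine lp.norm_le_of_tsum_le (by simp) (norm_nonneg _) ?_
    rw [lp.norm_rpow_eq_tsum (by simp)]
    -- The extended function is supported on the range of `of`, so the two sums of squares agree.
    refine (of_injective.tsum_eq ?_).symm.le
    rintro (_ | x) hx
    · simp at hx
    · exact ⟨x, rfl⟩

theorem norm_restrictL_le {S : Type u} : ‖restrictL (S := S)‖ ≤ 1 :=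
  LinearMap.mkContinuous_norm_le _ zero_le_one _

theorem norm_extendL_le {S : Type u} : ‖extendL (S := S)‖ ≤ 1 :=
  LinearMap.mkContinuous_norm_le _ zero_le_one _

theorem restrictL_apply {S : Type u} (ξ : L2 (RestrictedSemigroup S)) (x : S) :
    restrictL ξ x = ξ (of x) := rfl
theorem extendL_of {S : Type u} (ξ : L2 S) (x : S) : extendL ξ (of x) = ξ x := rfl
theorem extendL_zero {S : Type u} (ξ : L2 S) : extendL ξ zero = 0 := rfl

end L2

/-! ### The splitting of `Λ` along `ℓ²(S ∪ {0}) = ℂ ⊕ ℓ²(S)` -/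

theorem leftRegularOp_of_apply_of (x y : S) (ξ : L2 (RestrictedSemigroup S)) :
    leftRegularOp (of x) ξ (of y) = restrictedLeftRegularOp x (L2.restrictL ξ) y := by
  classical
  rw [leftRegularOp_apply, restrictedLeftRegularOp_apply]
  by_cases h : x * star x = y * star y
  · have hc : Composable S (star x) y := by rw [Composable, star_star, h]
    rw [if_pos h, if_pos ((idemLE_of_iff x y).2 h), star_of, of_mul_of, if_pos hc]
    rfl
  · rw [if_neg h, if_neg (mt (idemLE_of_iff x y).1 h)]

/-- The trivial summand: `0` lies below every idempotent and is fixed by every translation, so each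
`Λ x` preserves the coordinate at `0`. -/
theorem leftRegularOp_apply_zero (x : RestrictedSemigroup S) (ξ : L2 (RestrictedSemigroup S)) :
    leftRegularOp x ξ zero = ξ zero := by
  classical
  rw [leftRegularOp_apply, if_pos (idemLE_zero x), mul_zero']

/-- No nonzero idempotent lies below `0`. With the preceding lemma, `Λ 0` is the projection onto the
coordinate `0`. -/
theorem leftRegularOp_zero_apply_of (y : S) (ξ : L2 (RestrictedSemigroup S)) :
    leftRegularOp zero ξ (of y) = 0 := by
  classical
  rw [leftRegularOp_apply, if_neg (not_idemLE_zero y)]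

/-- `B ↦ A B C` as a bounded linear map. -/
def compCompL {E F G H : Type*} [NormedAddCommGroup E] [NormedSpace ℂ E]
    [NormedAddCommGroup F] [NormedSpace ℂ F] [NormedAddCommGroup G] [NormedSpace ℂ G]
    [NormedAddCommGroup H] [NormedSpace ℂ H] (A : G →L[ℂ] H) (C : E →L[ℂ] F) :
    (F →L[ℂ] G) →L[ℂ] E →L[ℂ] H :=
  (ContinuousLinearMap.compL ℂ E G H A).comp ((ContinuousLinearMap.compL ℂ E F G).flip C)

theorem compCompL_apply {E F G H : Type*} [NormedAddCommGroup E] [NormedSpace ℂ E]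
    [NormedAddCommGroup F] [NormedSpace ℂ F] [NormedAddCommGroup G] [NormedSpace ℂ G]
    [NormedAddCommGroup H] [NormedSpace ℂ H] (A : G →L[ℂ] H) (C : E →L[ℂ] F) (B : F →L[ℂ] G) :
    compCompL A C B = A.comp (B.comp C) := rfl

/-- Compression to `ℓ²(S)` annihilates `Λ 0` and carries `Λ x` to `λ_r x`, so no augmentation term
is needed here. -/
theorem tilde_restrictedLeftRegular (f : L1 (AllPairs (RestrictedSemigroup S))) :
    (restrictedLeftRegular S).tilde (restrict f) =
      L2.restrictL.comp (((leftRegular (RestrictedSemigroup S)).tilde f).comp L2.extendL) := by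
  refine apply_lift_restrict restrictedLeftRegularOp isRep_restrictedLeftRegularOp.norm_le
    (.id ℂ _) ((compCompL L2.restrictL L2.extendL).comp
      (L1.lift leftRegularOp isRep_leftRegularOp.norm_le)) ?_ (fun x => ?_) f
  all_goals
    rw [ContinuousLinearMap.comp_apply, L1.lift_delta, compCompL_apply]
    refine ContinuousLinearMap.ext fun ξ => lp.ext <| funext fun y => ?_
  · exact leftRegularOp_zero_apply_of y _
  · exact leftRegularOp_of_apply_of x y _

/-- In general `Λ̃ f` also has the summand `(∑ x, f x) • Λ 0` on the coordinate `0`; the hypothesis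
on the augmentation removes it and leaves only the block on `ℓ²(S)`. -/
theorem tilde_leftRegular (f : L1 (AllPairs (RestrictedSemigroup S)))
    (hf : augmentation f = 0) :
    (leftRegular (RestrictedSemigroup S)).tilde f =
      L2.extendL.comp (((restrictedLeftRegular S).tilde (restrict f)).comp L2.restrictL) := by
  have h := apply_lift_restrict restrictedLeftRegularOp isRep_restrictedLeftRegularOp.norm_le
    (compCompL L2.extendL L2.restrictL) (L1.lift leftRegularOp isRep_leftRegularOp.norm_le -
      augmentation.smulRight (leftRegularOp zero)) ?_ (fun x => ?_) f
  · rw [_root_.sub_apply, ContinuousLinearMap.smulRight_apply, hf, zero_smul, sub_zero] at h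
    exact h.symm
  all_goals
    rw [_root_.sub_apply, ContinuousLinearMap.smulRight_apply, augmentation_delta, one_smul,
      L1.lift_delta]
  · exact sub_self _
  · refine ContinuousLinearMap.ext fun ξ => lp.ext <| funext fun y => ?_
    change leftRegularOp (of x) ξ y - leftRegularOp zero ξ y =
      L2.extendL (restrictedLeftRegularOp x (L2.restrictL ξ)) y
    -- At `0` the contributions of `Λ x` and `Λ 0` are both `ξ 0` and cancel; at points of `S` the
    -- operator `Λ 0` contributes nothing.
    rcases y with _ | y
    · rw [leftRegularOp_apply_zero, leftRegularOp_apply_zero, sub_self, L2.extendL_zero]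
    · rw [leftRegularOp_of_apply_of, leftRegularOp_zero_apply_of, sub_zero, L2.extendL_of]

theorem norm_comp_comp_le {E F G H : Type*} [NormedAddCommGroup E] [NormedSpace ℂ E]
    [NormedAddCommGroup F] [NormedSpace ℂ F] [NormedAddCommGroup G] [NormedSpace ℂ G]
    [NormedAddCommGroup H] [NormedSpace ℂ H] {A : G →L[ℂ] H} (B : F →L[ℂ] G) {C : E →L[ℂ] F}
    (hA : ‖A‖ ≤ 1) (hC : ‖C‖ ≤ 1) : ‖A.comp (B.comp C)‖ ≤ ‖B‖ :=
  calc ‖A.comp (B.comp C)‖ ≤ ‖A‖ * (‖B‖ * ‖C‖) :=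
        (A.opNorm_comp_le _).trans (mul_le_mul_of_nonneg_left (B.opNorm_comp_le _) (norm_nonneg _))
    _ ≤ 1 * (‖B‖ * 1) := by gcongr
    _ = ‖B‖ := by ring

/-! ### Comparison of the norms of the regular representations -/

theorem repNorm_restrict_le_leftRegular (f : L1 (AllPairs (RestrictedSemigroup S))) :
    repNorm {restrictedLeftRegular S} (restrict f) ≤
      repNorm {leftRegular (RestrictedSemigroup S)} f := by
  rw [repNorm_singleton, repNorm_singleton, tilde_restrictedLeftRegular]
  exact norm_comp_comp_le _ L2.norm_restrictL_le L2.norm_extendL_le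

theorem repNorm_le_restrict_leftRegular (f : L1 (AllPairs (RestrictedSemigroup S)))
    (hf : augmentation f = 0) :
    repNorm {leftRegular (RestrictedSemigroup S)} f ≤
      repNorm {restrictedLeftRegular S} (restrict f) := by
  rw [repNorm_singleton, repNorm_singleton, tilde_leftRegular f hf]
  exact norm_comp_comp_le _ L2.norm_extendL_le L2.norm_restrictL_le

/-! ### The isomorphism of completions -/

section Iso

variable {F : Set (Rep (AllPairs (RestrictedSemigroup S)))} {G : Set (Rep (Composable S))}

/-- `restrict` as a contraction for the norms of two families of representations. -/
def restrictNormed (h1 : ∀ f, repNorm G (restrict f) ≤ repNorm F f) :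
    Normed F →L[ℂ] Normed G :=
  LinearMap.mkContinuous
    { toFun := fun f => restrict f
      map_add' := fun _ _ => rfl
      map_smul' := fun _ _ => rfl } 1 fun f => (h1 f).trans (one_mul _).ge

/-- The extension of `restrict` to the completions. -/
def restrictCStar (h1 : ∀ f, repNorm G (restrict f) ≤ repNorm F f) : CStar F →L[ℂ] CStar G :=
  (CStarCompletion.ι.comp (restrictNormed h1)).extend (CStarCompletion.ι (A := Normed F))

variable (h1 : ∀ f, repNorm G (restrict f) ≤ repNorm F f)

theorem restrictCStar_of (f : L1 (AllPairs (RestrictedSemigroup S))) :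
    restrictCStar h1 (CStar.of F f) = CStar.of G (restrict f) :=
  ContinuousLinearMap.extend_eq _ CStarCompletion.denseRange_ι
    (UniformSpace.Completion.isUniformInducing_coe (Normed F)) _

theorem CStar.induction {T : Type u} [Semigroup T] [InverseSemigroup T] {D : T → T → Prop}
    [IsProductDomain D] {F : Set (Rep D)} {p : CStar F → Prop} (x : CStar F)
    (hp : IsClosed {x | p x}) (h : ∀ f, p (CStar.of F f)) : p x :=
  CStarCompletion.induction_on x hp h

theorem CStar.of_mul {T : Type u} [Semigroup T] [InverseSemigroup T] {D : T → T → Prop}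
    [IsProductDomain D] (F : Set (Rep D)) (f g : L1 D) :
    CStar.of F (f * g) = CStar.of F f * CStar.of F g :=
  CStarCompletion.ι_mul (toNormed F f) (toNormed F g)

theorem CStar.of_star {T : Type u} [Semigroup T] [InverseSemigroup T] {D : T → T → Prop}
    [IsProductDomain D] (F : Set (Rep D)) (f : L1 D) :
    CStar.of F (star f) = star (CStar.of F f) :=
  CStarCompletion.ι_star (toNormed F f)

theorem restrictCStar_mul (x y : CStar F) :
    restrictCStar h1 (x * y) = restrictCStar h1 x * restrictCStar h1 y := by
  induction x using CStar.induction with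
  | hp => exact isClosed_eq (by fun_prop) (by fun_prop)
  | h f =>
    induction y using CStar.induction with
    | hp => exact isClosed_eq (by fun_prop) (by fun_prop)
    | h g =>
      rw [← CStar.of_mul, restrictCStar_of, restrictCStar_of, restrictCStar_of, restrict_mul,
        CStar.of_mul]

theorem restrictCStar_star (x : CStar F) :
    restrictCStar h1 (star x) = star (restrictCStar h1 x) := by
  induction x using CStar.induction with
  | hp => exact isClosed_eq (by fun_prop) (by fun_prop)
  | h f => rw [← CStar.of_star, restrictCStar_of, restrictCStar_of, restrict_star, CStar.of_star]

theorem norm_restrictCStar_le (x : CStar F) : ‖restrictCStar h1 x‖ ≤ ‖x‖ := by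
  induction x using CStar.induction with
  | hp => exact isClosed_le (by fun_prop) (by fun_prop)
  | h f =>
    rw [restrictCStar_of, CStar.norm_of, CStar.norm_of]
    exact h1 f

theorem restrictCStar_eq_zero {x : CStar F} (hx : x ∈ (zeroIdeal F).toSubmodule) :
    restrictCStar h1 x = 0 := by
  obtain ⟨c, rfl⟩ := Submodule.mem_span_singleton.1 hx
  rw [map_smul, restrictCStar_of, restrict_delta_zero]
  exact (congrArg (c • ·) (map_zero (CStarCompletion.ι (A := Normed G)))).trans (smul_zero c)

/-! ### The quotient norm modulo `ℂ δ₀` -/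

theorem ClosedIdeal.norm_proj_le {B : Type u} [NonUnitalCStarAlgebra B] (J : ClosedIdeal B)
    (x : B) : ‖J.proj x‖ ≤ ‖x‖ := by
  rw [norm_proj, ← dist_zero_right x]
  exact Metric.infDist_le_dist_of_mem J.toSubmodule.zero_mem

theorem ClosedIdeal.continuous_proj {B : Type u} [NonUnitalCStarAlgebra B] (J : ClosedIdeal B) :
    Continuous J.proj :=
  AddMonoidHomClass.continuous_of_bound J.proj 1 fun x =>
    (J.norm_proj_le x).trans (one_mul _).ge

/-- The quotient norm is an infimum over a coset of `ℂ δ₀`. The extended restriction is a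
contraction that is constant on the coset, which gives `≤`; for `≥` one representative of
augmentation zero is enough. -/
theorem norm_restrictCStar (h2 : ∀ f, augmentation f = 0 → repNorm F f ≤ repNorm G (restrict f))
    (x : CStar F) : ‖restrictCStar h1 x‖ = ‖(zeroIdeal F).proj x‖ := by
  refine le_antisymm ?_ ?_
  · rw [ClosedIdeal.norm_proj]
    refine (Metric.le_infDist ⟨0, (zeroIdeal F).toSubmodule.zero_mem⟩).2 fun y hy => ?_
    -- Since `y` is sent to `0`, the images of `x` and `x - y` coincide.
    rw [dist_eq_norm, ← sub_zero (restrictCStar h1 x), ← restrictCStar_eq_zero h1 hy, ← map_sub]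
    exact norm_restrictCStar_le h1 _
  · induction x using CStar.induction with
    | hp =>
      exact isClosed_le (zeroIdeal F).continuous_proj.norm (restrictCStar h1).continuous.norm
    | h f =>
      -- The representative of augmentation zero: `δ₀` has augmentation `1` and restricts to `0`, so
      -- `g` has the same restriction and the same class as `f`.
      set g := f - augmentation f • L1.delta _ zero with hg
      have hg0 : augmentation g = 0 := by
        rw [hg, map_sub, map_smul, augmentation_delta, smul_eq_mul, mul_one, sub_self]
      have hgr : restrict g = restrict f := by
        rw [hg, ← restrictL_apply, map_sub, map_smul, restrictL_apply, restrictL_apply,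
          restrict_delta_zero, smul_zero, sub_zero]
      have hp : (zeroIdeal F).proj (CStar.of F f) = (zeroIdeal F).proj (CStar.of F g) := by
        refine ClosedIdeal.proj_eq_proj.2 (Submodule.mem_span_singleton.2 ⟨augmentation f, ?_⟩)
        have : CStar.of F g = CStar.of F f - augmentation f • deltaZero F :=
          (map_sub (CStarCompletion.ι (A := Normed F)) _ _).trans
            (congrArg (CStar.of F f - ·) (map_smul (CStarCompletion.ι (A := Normed F)) _ _))
        rw [this, sub_sub_cancel]
      rw [hp, restrictCStar_of, ← hgr, CStar.norm_of]
      exact (ClosedIdeal.norm_proj_le _ _).trans ((CStar.norm_of F g).trans_le (h2 g hg0))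

/-- The map induced by `restrictCStar` on the quotient by `ℂ δ₀`. -/
def quotRestrict : (zeroIdeal F).Quot →ₗ[ℂ] CStar G :=
  (zeroIdeal F).toSubmodule.liftQ (restrictCStar h1).toLinearMap fun _ hx =>
    restrictCStar_eq_zero h1 hx

theorem isometry_quotRestrict
    (h2 : ∀ f, augmentation f = 0 → repNorm F f ≤ repNorm G (restrict f)) :
    Isometry (quotRestrict h1) := by
  refine AddMonoidHomClass.isometry_of_norm _ fun x => ?_
  obtain ⟨x, rfl⟩ := ClosedIdeal.proj_surjective x
  exact norm_restrictCStar h1 h2 x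

/-- An isometry out of a complete space has closed range, and this range contains the dense image of
`ℓ¹_r(S)`, because restriction is onto already at the level of `ℓ¹`. -/
theorem quotRestrict_surjective
    (h2 : ∀ f, augmentation f = 0 → repNorm F f ≤ repNorm G (restrict f)) :
    Function.Surjective (quotRestrict h1) := fun y => by
  have : IsClosed ((zeroIdeal F).toSubmodule : Set (CStar F)) := (zeroIdeal F).isClosed
  have : CompleteSpace (zeroIdeal F).Quot :=
    inferInstanceAs (CompleteSpace (CStar F ⧸ (zeroIdeal F).toSubmodule))
  induction y using CStar.induction with
  | hp => exact (isometry_quotRestrict h1 h2).isClosedEmbedding.isClosed_range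
  | h g =>
    obtain ⟨f, rfl⟩ := restrict_surjective g
    exact ⟨(zeroIdeal F).proj (CStar.of F f), restrictCStar_of h1 f⟩

/-- The criterion common to both isomorphisms: only the two norm estimates depend on the chosen
families. Multiplicativity and compatibility with the involution descend from `restrictCStar` along
the quotient map. -/
theorem exists_quot_starAlgEquiv
    (h1 : ∀ f, repNorm G (restrict f) ≤ repNorm F f)
    (h2 : ∀ f, augmentation f = 0 → repNorm F f ≤ repNorm G (restrict f)) :
    ∃ Φ : (zeroIdeal F).Quot ≃⋆ₐ[ℂ] CStar G, Isometry Φ ∧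
      ∀ f, Φ ((zeroIdeal F).proj (CStar.of F f)) = CStar.of G (restrict f) :=
  ⟨{ Equiv.ofBijective (quotRestrict h1)
        ⟨(isometry_quotRestrict h1 h2).injective, quotRestrict_surjective h1 h2⟩ with
      map_add' := fun x y => map_add (quotRestrict h1) x y
      map_smul' := fun c x => map_smul (quotRestrict h1) c x
      map_mul' := fun x y => by
        obtain ⟨x, rfl⟩ := ClosedIdeal.proj_surjective x
        obtain ⟨y, rfl⟩ := ClosedIdeal.proj_surjective y
        exact restrictCStar_mul h1 x y
      map_star' := fun x => by
        obtain ⟨x, rfl⟩ := ClosedIdeal.proj_surjective x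
        exact restrictCStar_star h1 x },
    isometry_quotRestrict h1 h2, restrictCStar_of h1⟩

end Iso

end RestrictedAlgebra

end

theorem proposition4p1 (S : Type*) [Monoid S] [RestrictedAlgebra.InverseSemigroup S] :
    (∃ Φ : (RestrictedAlgebra.zeroIdeal (S := S)
          {RestrictedAlgebra.leftRegular (RestrictedAlgebra.RestrictedSemigroup S)}).Quot ≃⋆ₐ[ℂ]
        RestrictedAlgebra.RestrictedReducedCStar S,
      Isometry Φ ∧
      ∀ f : RestrictedAlgebra.L1
          (RestrictedAlgebra.AllPairs (RestrictedAlgebra.RestrictedSemigroup S)),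
        Φ ((RestrictedAlgebra.zeroIdeal _).proj (RestrictedAlgebra.CStar.of _ f)) =
          RestrictedAlgebra.CStar.of _ (RestrictedAlgebra.restrict f)) ∧
    (∃ Φ : (RestrictedAlgebra.zeroIdeal (S := S) Set.univ).Quot ≃⋆ₐ[ℂ]
        RestrictedAlgebra.RestrictedFullCStar S,
      Isometry Φ ∧
      ∀ f : RestrictedAlgebra.L1
          (RestrictedAlgebra.AllPairs (RestrictedAlgebra.RestrictedSemigroup S)),
        Φ ((RestrictedAlgebra.zeroIdeal _).proj (RestrictedAlgebra.CStar.of _ f)) =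
          RestrictedAlgebra.CStar.of _ (RestrictedAlgebra.restrict f)) := by
  open RestrictedAlgebra in
  exact ⟨exists_quot_starAlgEquiv repNorm_restrict_le_leftRegular repNorm_le_restrict_leftRegular,
    exists_quot_starAlgEquiv repNorm_restrict_le_univ repNorm_le_restrict_univ⟩
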